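/- Let $I=[0,1]$ with Lebesgue measure $\lambda$. Let $1=a_0>a_1>a_2>\cdots$ with $a_n\to 0$, and let $\tau:I\to I$ be such that for every $n\ge 0$ the restriction of $\tau$ to $[a_{n+1},a_n)$ is continuous and convex, for every $n\ge 1$ we have $\tau(a_n)=0$ and the right derivative satisfies $\tau'(a_n)>0$, and $\sum_{n\ge1}1/\tau'(a_n)<\infty$ (i.e. $\tau\in\mathcal T_{pc}^{\infty,0}(I)$ and $0$ is the only limit point of the partition points). For $n\ge1$ let $\tau_n(x)=x/a_n$ for $0\le x<a_n$ and $\tau_n(x)=\tau(x)$ for $a_n\le x\le 1$. For a nonsingular map $T:I\to I$ let $P_T$ be its Frobenius--Perron operator on $L^1(I,\lambda)$, defined by $\int_A P_Tf\,d\lambda=\int_{T^{-1}(A)}f\,d\lambda$ for all measurable $A$. For $k\ge 1$ let $J_1,\dots,J_k$ be the partition of $I$ into $k$ equal subintervals, and let the Ulam operator $P_{\tau_n}^{(k)}$ act on step functions $f=\sum_{i=1}^k f_i\chi_{J_i}$ by $$P_{\tau_n}^{(k)}f=\sum_{j=1}^k\Big(\sum_{i=1}^k f_i\,\frac{\lambda(\tau_n^{-1}(J_j)\cap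 J_i)}{\lambda(J_i)}\Big)\chi_{J_j}.$$ Then for all $n,k\ge1$ the operator $P_{\tau_n}^{(k)}$ has exactly one nonnegative fixed point $f_{n,k}$ with $\|f_{n,k}\|_1=1$, and: 1. the family $\{f_{n,k}\}_{n,k\ge1}$ is uniformly bounded in $L^\infty$ and relatively weakly compact in $L^1$; 2. if a sequence $f_{n_j,k_j}$, $j=1,2,\dots$, of members of the family converges weakly in $L^1$ to $f$, then it converges to $f$ in $L^1$ and almost everywhere; if moreover $n_j\to\infty$ and $k_j\to\infty$, then $P_\tau f=f$; 3. $\tau$ has exactly one invariant density $f^*$ ($f^*\ge0$, $\|f^*\|_1=1$, $P_\tau f^*=f^*$), and $f_{n,k}\to f^*$ as $n,k\to\infty$, both in $L^1$ and almost everywhere. -/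

import Mathlib

open MeasureTheory Set Filter Topology
open scoped ENNReal Matrix

noncomputable section

/-- Normalized Lebesgue measure on `I = [0,1]`, viewed as a measure on `ℝ`. -/
def lebI : Measure ℝ := volume.restrict (Icc (0 : ℝ) 1)

/-- The class of piecewise convex maps of `[0,1]` with countably many branches whose partition
points `1 = a 0 > a 1 > a 2 > ⋯` accumulate exactly at `0`. The slope `τ'(a n)` is the derivative
from the right; since `derivWithin` is `0` where there is no derivative, `deriv_pos` includes its
existence. Values of `τ` outside `[0,1]` are irrelevant. -/
structure IsPiecewiseConvexZero (τ : ℝ → ℝ) (a : ℕ → ℝ) : Prop where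
  a_zero : a 0 = 1
  a_anti : StrictAnti a
  a_lim : Tendsto a atTop (𝓝 0)
  mapsTo : MapsTo τ (Icc 0 1) (Icc 0 1)
  branch_cont : ∀ n, ContinuousOn τ (Ico (a (n + 1)) (a n))
  branch_convex : ∀ n, ConvexOn ℝ (Ico (a (n + 1)) (a n)) τ
  branch_zero : ∀ n, 1 ≤ n → τ (a n) = 0
  deriv_pos : ∀ n, 1 ≤ n → 0 < derivWithin τ (Ioi (a n)) (a n)
  summable_inv_deriv : Summable fun n : ℕ => 1 / derivWithin τ (Ioi (a (n + 1))) (a (n + 1))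

/-- The finite-branch approximation `τ_n`: `x / a_n` on `[0, a_n)` and `τ` on `[a_n, 1]`. -/
def approxMap (τ : ℝ → ℝ) (a : ℕ → ℝ) (n : ℕ) (x : ℝ) : ℝ :=
  if x < a n then x / a n else τ x

/-- The push-forward under `T` of the measure `f⁺ dλ`, as a density. -/
def pushDensity (T : ℝ → ℝ) (f : ℝ → ℝ) (x : ℝ) : ℝ :=
  (((lebI.withDensity fun y => ENNReal.ofReal (f y)).map T).rnDeriv lebI x).toReal

/-- The Frobenius-Perron operator `P_T`: the density with respect to `λ` of the push-forward
under `T` of the signed measure `f dλ = f⁺ dλ - f⁻ dλ`. -/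
def frobeniusPerron (T : ℝ → ℝ) (f : ℝ → ℝ) (x : ℝ) : ℝ :=
  pushDensity T f x - pushDensity T (fun y => -f y) x

instance : IsFiniteMeasure lebI := by unfold lebI; infer_instance

/-- The `i`-th of the `k` equal subintervals of `[0,1]`. -/
def cell (k : ℕ) (i : Fin k) : Set ℝ := Ico ((i : ℝ) / k) (((i : ℝ) + 1) / k)

/-- The Ulam matrix `λ(T⁻¹ J_j ∩ J_i) / λ(J_i)`. -/
def ulamMatrix (T : ℝ → ℝ) (k : ℕ) : Matrix (Fin k) (Fin k) ℝ :=
  Matrix.of fun i j => lebI.real (T ⁻¹' cell k j ∩ cell k i) / lebI.real (cell k i)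

/-- The Ulam operator `P_T^{(k)}` on step functions, written as row vectors. -/
def ulamOp (T : ℝ → ℝ) (k : ℕ) (v : Fin k → ℝ) : Fin k → ℝ := v ᵥ* ulamMatrix T k

/-- The step function `∑ i, v i * χ_{J_i}`. -/
def stepFn (k : ℕ) (v : Fin k → ℝ) (x : ℝ) : ℝ :=
  ∑ i : Fin k, (cell k i).indicator (fun _ => v i) x

theorem memLp_stepFn (k : ℕ) (v : Fin k → ℝ) : MemLp (stepFn k v) 1 lebI := by
  unfold stepFn
  refine memLp_finsetSum _ fun i _ => ?_
  exact (memLp_const (v i)).indicator measurableSet_Ico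

/-- The step function as an element of `L¹`. -/
def stepL1 (k : ℕ) (v : Fin k → ℝ) : Lp ℝ 1 lebI := (memLp_stepFn k v).toLp (stepFn k v)

/-- `v` represents a (nonnegative) fixed point of the Ulam operator, normalized in `L¹`. -/
def IsUlamDensity (T : ℝ → ℝ) (k : ℕ) (v : Fin k → ℝ) : Prop :=
  (∀ i, 0 ≤ v i) ∧ ulamOp T k v = v ∧ ‖stepL1 k v‖ = 1

/-- `f` is a probability density fixed by the Frobenius-Perron operator of `T`. -/
def IsInvariantDensity (T : ℝ → ℝ) (f : Lp ℝ 1 lebI) : Prop :=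
  0 ≤ᵐ[lebI] f ∧ ‖f‖ = 1 ∧ frobeniusPerron T f =ᵐ[lebI] f

theorem pushDensity_spec {T f : ℝ → ℝ} (hT : AEMeasurable T lebI)
    (hns : lebI.map T ≪ lebI) (hf : Integrable f lebI) :
    Integrable (pushDensity T f) lebI ∧ ∀ A, MeasurableSet A →
      ∫ x in A, pushDensity T f x ∂lebI = ∫ x in T ⁻¹' A, max (f x) 0 ∂lebI := by
  set ν := lebI.withDensity fun y => ENNReal.ofReal (f y) with hν
  have hfin : IsFiniteMeasure ν := isFiniteMeasure_withDensity_ofReal hf.2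
  have hνac : ν ≪ lebI := withDensity_absolutelyContinuous _ _
  have hT' : AEMeasurable T ν := hT.mono_ac hνac
  have hac : ν.map T ≪ lebI := by
    refine Measure.AbsolutelyContinuous.mk fun s hs h0 => ?_
    have h := hns h0
    rw [Measure.map_apply_of_aemeasurable hT hs] at h
    rw [Measure.map_apply_of_aemeasurable hT' hs]
    exact hνac h
  refine ⟨Measure.integrable_toReal_rnDeriv, fun A hA => ?_⟩
  have h1 : ∫ x in A, pushDensity T f x ∂lebI = (ν.map T).real A :=
    Measure.setIntegral_toReal_rnDeriv hac A
  have hnull : NullMeasurableSet (T ⁻¹' A) lebI := hT.nullMeasurableSet_preimage hA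
  rw [h1, Measure.real, Measure.map_apply_of_aemeasurable hT' hA, hν,
    withDensity_apply₀ _ hnull, integral_eq_lintegral_of_nonneg_ae]
  · congr 1
    refine lintegral_congr fun x => ?_
    rw [ENNReal.ofReal_max]
    simp
  · exact Eventually.of_forall fun x => le_max_right _ _
  · exact (hf.pos_part.1).mono_measure Measure.restrict_le_self

/-- The defining identity of the Frobenius-Perron operator of a nonsingular map. -/
theorem frobeniusPerron_spec {T f : ℝ → ℝ} (hT : AEMeasurable T lebI)
    (hns : lebI.map T ≪ lebI) (hf : Integrable f lebI) :
    Integrable (frobeniusPerron T f) lebI ∧ ∀ A, MeasurableSet A →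
      ∫ x in A, frobeniusPerron T f x ∂lebI = ∫ x in T ⁻¹' A, f x ∂lebI := by
  obtain ⟨h1, h2⟩ := pushDensity_spec hT hns hf
  obtain ⟨h3, h4⟩ := pushDensity_spec hT hns hf.neg
  refine ⟨h1.sub h3, fun A hA => ?_⟩
  have e : ∫ x in A, frobeniusPerron T f x ∂lebI
      = ∫ x in A, pushDensity T f x ∂lebI - ∫ x in A, pushDensity T (-f) x ∂lebI :=
    integral_sub h1.integrableOn h3.integrableOn
  rw [e, h2 A hA, h4 A hA, ← integral_sub hf.pos_part.integrableOn hf.neg.pos_part.integrableOn]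
  refine integral_congr_ae (Eventually.of_forall fun x => ?_)
  simp only [Pi.neg_apply]
  rcases le_total (f x) 0 with h | h
  · rw [max_eq_right h, max_eq_left (by linarith)]; ring
  · rw [max_eq_left h, max_eq_right (by linarith)]; ring

end

/-! Every branch is convex, increasing and starts at the value 0, so its inverse, prolonged by the
right end point of the branch, is concave and increasing. The distribution function of a
push-forward is a sum of compositions with these inverses, hence concave whenever the original one
is: the push-forward preserves decreasing densities (`IsConvexBranched.cum_map_concave`). The Ulam
operator is this push-forward followed by averaging over cells, so it preserves decreasing vectors,
and a fixed point argument on a compact convex set gives a decreasing fixed vector.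

Uniqueness of this vector is combinatorial. The cells charged by a fixed vector are forward
invariant. A run of charged cells that misses the first cell lies in a single branch, and by
convexity its image covers a run that is strictly longer in a suitable order
(`exists_longer_support`). This cannot go on forever, so every nonzero nonnegative fixed vector
charges the first cell. Applied to the positive part of a difference, this gives uniqueness, and
therefore the fixed vector is decreasing.

A decreasing density of mass 1 is at most `1/x` at `x`. Estimating the value on the first cell
branch by branch bounds finitely many branches by a constant, the remaining original branches by a
small multiple of the value itself (summability of the inverse slopes), and the linear branch by `a
n ≤ a 1 < 1` times it. This is the uniform bound (`exists_bound`).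

Bounded decreasing densities have equi-Lipschitz concave distribution functions. Pointwise
convergence of these forces convergence of the densities wherever the limit is differentiable, hence
almost everywhere, and then in `L¹` by dominated convergence. So the family is even norm precompact,
and weak convergence suffices for strong convergence. The distribution functions of a fixed density
and of its image under `τ` differ by at most `C * a n + C / k`, so limits along `n, k → ∞` are
invariant.

For `τ` itself, two points with the same itinerary coincide, because either lengths or relative
lengths would grow without bound. Hence iterating the push-forward turns any step density into a
nearly decreasing one, and every invariant density is decreasing (`cum_concave_of_invariant`). The
positive and negative parts of the difference of two invariant densities are invariant with equal
mass, hence both decreasing, but they have disjoint supports; near 0 this is possible only if both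
vanish. Compactness together with uniqueness of the limit gives convergence of the whole family. -/

/-! ### Maps with convex branches and their action on decreasing densities -/

/-- A Borel map of `[0,1]` into `[0,1)` with convex branches on `[b (m+1), b m)`, each of them
starting at the value `0` and expanding distances by at least the factor `c m`. Once `b` reaches
`0` the remaining branches are empty. -/
structure IsConvexBranched (T : ℝ → ℝ) (b c : ℕ → ℝ) : Prop where
  meas : Measurable T
  maps : ∀ x, T x ∈ Ico (0 : ℝ) 1
  b_zero : b 0 = 1
  anti : Antitone b
  lim : Tendsto b atTop (𝓝 0)
  strict : ∀ m, 0 < b m → b (m + 1) < b m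
  cont : ∀ m, ContinuousOn T (Ico (b (m + 1)) (b m))
  conv : ∀ m, ConvexOn ℝ (Ico (b (m + 1)) (b m)) T
  zero : ∀ m, 0 < b m → T (b (m + 1)) = 0
  c_pos : ∀ m, 0 < c m
  slope : ∀ m, ∀ x ∈ Ico (b (m + 1)) (b m), ∀ y ∈ Ico (b (m + 1)) (b m), x ≤ y →
    c m * (y - x) ≤ T y - T x
  c_last : ∀ m, 0 < b m → b (m + 1) = 0 → 1 < c m

/-- The inverse of the `m`-th branch, extended by the right end point of the branch. -/
noncomputable def branchInv (T : ℝ → ℝ) (b : ℕ → ℝ) (m : ℕ) (t : ℝ) : ℝ :=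
  sSup (insert (b (m + 1)) {x ∈ Ico (b (m + 1)) (b m) | T x ≤ t})

/-- The distribution function of a measure on the line. -/
noncomputable def cum (μ : Measure ℝ) (t : ℝ) : ℝ := μ.real (Iio t)

theorem cum_mono (μ : Measure ℝ) [IsFiniteMeasure μ] : Monotone (cum μ) :=
  fun _ _ h => measureReal_mono (Iio_subset_Iio h)

theorem measureReal_Ico_eq_cum (μ : Measure ℝ) [IsFiniteMeasure μ] {s t : ℝ} (h : s ≤ t) :
    μ.real (Ico s t) = cum μ t - cum μ s := by
  have : Ico s t = Iio t \ Iio s := by ext x; simp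
  rw [this, measureReal_sdiff (Iio_subset_Iio h) measurableSet_Iio]
  rfl

theorem ae_lebI_mem_Ioo : ∀ᵐ x ∂lebI, x ∈ Ioo (0 : ℝ) 1 := by
  have : lebI = volume.restrict (Ioo (0 : ℝ) 1) := by
    unfold lebI; exact Measure.restrict_congr_set Ioo_ae_eq_Icc.symm
  rw [this]
  exact ae_restrict_mem measurableSet_Ioo

theorem hasSum_measureReal_iUnion {μ : Measure ℝ} [IsFiniteMeasure μ] {s : ℕ → Set ℝ}
    (hd : Pairwise (Function.onFun Disjoint s)) (hs : ∀ m, MeasurableSet (s m)) :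
    HasSum (fun m => μ.real (s m)) (μ.real (⋃ m, s m)) := by
  have h := measure_iUnion (μ := μ) hd hs
  have hne : ∑' m, μ (s m) ≠ ∞ := by rw [← h]; exact measure_ne_top _ _
  have h2 := ENNReal.hasSum_toReal hne
  rw [Measure.real, h]
  rw [ENNReal.tsum_toReal_eq (fun m => measure_ne_top _ _)]
  exact h2

theorem exists_mem_Ico_of_tendsto_zero {b : ℕ → ℝ} (b_zero : b 0 = 1)
    (lim : Tendsto b atTop (𝓝 0)) {x : ℝ} (hx : x ∈ Ioo (0 : ℝ) 1) :
    ∃ m, x ∈ Ico (b (m + 1)) (b m) := by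
  have hex : ∃ m, b m ≤ x := ((lim.eventually (gt_mem_nhds hx.1)).exists).imp fun _ h => h.le
  classical
  set m := Nat.find hex
  have hm : b m ≤ x := Nat.find_spec hex
  have h0 : m ≠ 0 := by
    intro h0
    rw [h0, b_zero] at hm
    linarith [hx.2]
  obtain ⟨l, hl⟩ := Nat.exists_eq_succ_of_ne_zero h0
  refine ⟨l, ?_, ?_⟩
  · rw [← Nat.succ_eq_add_one, ← hl]; exact hm
  · exact not_le.1 (Nat.find_min hex (m := l) (by omega))

namespace IsConvexBranched

variable {T : ℝ → ℝ} {b c : ℕ → ℝ}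

theorem b_nonneg (h : IsConvexBranched T b c) (m : ℕ) : 0 ≤ b m := h.anti.le_of_tendsto h.lim m

theorem b_le_one (h : IsConvexBranched T b c) (m : ℕ) : b m ≤ 1 := by
  rw [← h.b_zero]; exact h.anti (Nat.zero_le m)

theorem exists_branch (h : IsConvexBranched T b c) {x : ℝ} (hx : x ∈ Ioo (0 : ℝ) 1) :
    ∃ m, x ∈ Ico (b (m + 1)) (b m) :=
  exists_mem_Ico_of_tendsto_zero h.b_zero h.lim hx

theorem disjoint_branches (h : IsConvexBranched T b c) :
    Pairwise (Function.onFun Disjoint fun m => Ico (b (m + 1)) (b m)) := by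
  intro i j hij
  refine Set.disjoint_left.2 fun x hi hj => ?_
  rcases lt_or_gt_of_ne hij with h1 | h1
  · have := h.anti (show i + 1 ≤ j by omega)
    linarith [hi.1, hj.2]
  · have := h.anti (show j + 1 ≤ i by omega)
    linarith [hj.1, hi.2]

theorem strictMonoOn (h : IsConvexBranched T b c) (m : ℕ) :
    StrictMonoOn T (Ico (b (m + 1)) (b m)) := by
  intro x hx y hy hxy
  have := h.slope m x hx y hy hxy.le
  have := mul_pos (h.c_pos m) (sub_pos.2 hxy)
  linarith

theorem bddAbove (h : IsConvexBranched T b c) (m : ℕ) (t : ℝ) :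
    BddAbove (insert (b (m + 1)) {x ∈ Ico (b (m + 1)) (b m) | T x ≤ t}) := by
  refine ⟨b m, ?_⟩
  rintro x (rfl | hx)
  · exact h.anti (Nat.le_succ m)
  · exact hx.1.2.le

theorem branchInv_mem (h : IsConvexBranched T b c) (m : ℕ) (t : ℝ) : branchInv T b m t ∈ Icc
    (b (m + 1)) (b m) := by
  refine ⟨le_csSup (h.bddAbove m t) (mem_insert _ _), csSup_le ⟨_, mem_insert _ _⟩ ?_⟩
  rintro x (rfl | hx)
  · exact h.anti (Nat.le_succ m)
  · exact hx.1.2.le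

theorem le_branchInv (h : IsConvexBranched T b c) {m : ℕ} {t x : ℝ}
    (hx : x ∈ Ico (b (m + 1)) (b m)) (hxt : T x ≤ t) :
    x ≤ branchInv T b m t :=
  le_csSup (h.bddAbove m t) (mem_insert_of_mem _ ⟨hx, hxt⟩)

theorem pos_of_mem_branch (h : IsConvexBranched T b c) {m : ℕ} {x : ℝ}
    (hx : x ∈ Ico (b (m + 1)) (b m)) : 0 < b m :=
  (h.b_nonneg (m + 1)).trans_lt (hx.1.trans_lt hx.2)

/-- Strict monotonicity makes the preimage an initial piece of the branch. The supremum in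
`branchInv` is over `T x ≤ t`, yet it bounds the strict preimage exactly, since by right continuity
a point with `T x < t` has such points to its right. -/
theorem preimage_inter_branch (h : IsConvexBranched T b c) (m : ℕ) (t : ℝ) :
    T ⁻¹' Iio t ∩ Ico (b (m + 1)) (b m) = Ico (b (m + 1)) (branchInv T b m t) := by
  ext x
  constructor
  · rintro ⟨hxt, hx⟩
    refine ⟨hx.1, ?_⟩
    have hc : ContinuousWithinAt T (Ico x (b m)) x :=
      (h.cont m x hx).mono (Ico_subset_Ico_left hx.1)
    have he : ∀ᶠ y in 𝓝[Ico x (b m)] x, T y < t := hc (gt_mem_nhds hxt)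
    rw [nhdsWithin_Ico_eq_nhdsGE hx.2] at he
    have he2 : ∀ᶠ y in 𝓝[>] x, T y < t ∧ y ∈ Ioo x (b m) :=
      (he.filter_mono (nhdsWithin_mono _ Ioi_subset_Ici_self)).and (Ioo_mem_nhdsGT hx.2)
    obtain ⟨y, hy1, hy2⟩ := he2.exists
    exact hy2.1.trans_le (h.le_branchInv ⟨hx.1.trans hy2.1.le, hy2.2⟩ hy1.le)
  · rintro ⟨hx1, hx2⟩
    obtain ⟨y, hy, hxy⟩ := exists_lt_of_lt_csSup ⟨_, mem_insert _ _⟩ hx2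
    rcases hy with rfl | hy
    · exact absurd hxy (not_lt.2 hx1)
    · have hx : x ∈ Ico (b (m + 1)) (b m) := ⟨hx1, hxy.trans hy.1.2⟩
      exact ⟨(h.strictMonoOn m hx hy.1 hxy).trans_le hy.2, hx⟩

/-- Sublevel sets of a convex function combine convexly, and suprema inherit this. Levels below 0
are excluded because there the value is stuck at the left end point, which would create a convex
corner at 0. -/
theorem branchInv_concave (h : IsConvexBranched T b c) (m : ℕ) : ConcaveOn ℝ (Ici 0)
    (branchInv T b m) := by
  refine ⟨convex_Ici 0, fun s hs t ht p q hp hq hpq => ?_⟩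
  simp only [smul_eq_mul]
  by_cases hb : 0 < b m
  · have hl : b (m + 1) ∈ Ico (b (m + 1)) (b m) := ⟨le_rfl, h.strict m hb⟩
    have key : ∀ r, 0 ≤ r →
        insert (b (m + 1)) {x ∈ Ico (b (m + 1)) (b m) | T x ≤ r}
          = {x ∈ Ico (b (m + 1)) (b m) | T x ≤ r} := by
      intro r hr
      refine insert_eq_of_mem ⟨hl, ?_⟩
      rw [h.zero m hb]; exact hr
    have hne : ∀ r, 0 ≤ r → {x ∈ Ico (b (m + 1)) (b m) | T x ≤ r}.Nonempty :=
      fun r hr => ⟨_, hl, by rw [h.zero m hb]; exact hr⟩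
    have step : ∀ x ∈ {x ∈ Ico (b (m + 1)) (b m) | T x ≤ s},
        ∀ y ∈ {x ∈ Ico (b (m + 1)) (b m) | T x ≤ t},
        p * x + q * y ≤ branchInv T b m (p * s + q * t) := by
      rintro x ⟨hx, hxs⟩ y ⟨hy, hyt⟩
      refine h.le_branchInv ((convex_Ico _ _) hx hy hp hq hpq) ?_
      have := (h.conv m).2 hx hy hp hq hpq
      simp only [smul_eq_mul] at this
      have := mul_le_mul_of_nonneg_left hxs hp
      have := mul_le_mul_of_nonneg_left hyt hq
      linarith
    have h1 : ∀ y ∈ {x ∈ Ico (b (m + 1)) (b m) | T x ≤ t},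
        p * branchInv T b m s + q * y ≤ branchInv T b m (p * s + q * t) := by
      intro y hy
      rcases hp.eq_or_lt with rfl | hp'
      · obtain ⟨x, hx⟩ := hne s hs
        simpa using step x hx y hy
      · have : branchInv T b m s ≤ (branchInv T b m (p * s + q * t) - q * y) / p := by
          unfold branchInv
          rw [key s hs]
          refine csSup_le (hne s hs) fun x hx => ?_
          rw [le_div_iff₀ hp']
          have := step x hx y hy
          unfold branchInv at this
          linarith
        rw [le_div_iff₀ hp'] at this
        linarith
    rcases hq.eq_or_lt with rfl | hq'
    · obtain ⟨x, hx⟩ := hne t ht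
      simpa using h1 x hx
    · have : branchInv T b m t
          ≤ (branchInv T b m (p * s + q * t) - p * branchInv T b m s) / q := by
        conv_lhs => unfold branchInv
        rw [key t ht]
        refine csSup_le (hne t ht) fun x hx => ?_
        rw [le_div_iff₀ hq']
        have := h1 x hx
        linarith
      rw [le_div_iff₀ hq'] at this
      linarith
  · have hbm : b m = 0 := le_antisymm (not_lt.1 hb) (h.b_nonneg m)
    have hz : ∀ r, branchInv T b m r = 0 := fun r => by
      have h1 := h.branchInv_mem m r
      exact le_antisymm (hbm ▸ h1.2) ((h.b_nonneg _).trans h1.1)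
    simp [hz]

theorem comp_branchInv_concave (h : IsConvexBranched T b c) (m : ℕ) {G : ℝ → ℝ} {x : ℝ}
    (hG : ConcaveOn ℝ (Icc x (b m)) G) (hmono : Monotone G) {s : Set ℝ} (hs : Convex ℝ s)
    (hs0 : s ⊆ Ici 0) (hsx : ∀ t ∈ s, x ≤ branchInv T b m t) :
    ConcaveOn ℝ s fun t => G (branchInv T b m t) := by
  refine ⟨hs, fun u hu t ht p q hp hq hpq => ?_⟩
  refine (hG.2 ⟨hsx u hu, (h.branchInv_mem m u).2⟩ ⟨hsx t ht, (h.branchInv_mem m t).2⟩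
    hp hq hpq).trans (hmono ((h.branchInv_concave m).2 (hs0 hu) (hs0 ht) hp hq hpq))

theorem ae_mem_iUnion_branch (h : IsConvexBranched T b c) :
    ∀ᵐ x ∂lebI, x ∈ ⋃ m, Ico (b (m + 1)) (b m) := by
  filter_upwards [ae_lebI_mem_Ioo] with x hx
  exact mem_iUnion.2 (h.exists_branch hx)

/-- The branch form of the Frobenius–Perron operator, integrated: no derivatives of the branches are
needed. -/
theorem hasSum_cum_map (h : IsConvexBranched T b c) {μ : Measure ℝ} [IsFiniteMeasure μ]
    (hμ : μ ≪ lebI) (t : ℝ) :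
    HasSum (fun m => cum μ (branchInv T b m t) - cum μ (b (m + 1))) (cum (μ.map T) t) := by
  have e1 : cum (μ.map T) t = μ.real (⋃ m, T ⁻¹' Iio t ∩ Ico (b (m + 1)) (b m)) := by
    rw [cum, map_measureReal_apply h.meas measurableSet_Iio, ← inter_iUnion]
    refine measureReal_congr ?_
    filter_upwards [hμ.ae_le h.ae_mem_iUnion_branch] with x hx
    exact propext ⟨fun hx' => ⟨hx', hx⟩, fun hx' => hx'.1⟩
  rw [e1]
  have := hasSum_measureReal_iUnion (μ := μ)
    (s := fun m => T ⁻¹' Iio t ∩ Ico (b (m + 1)) (b m))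
    (fun i j hij => (h.disjoint_branches hij).mono inter_subset_right inter_subset_right)
    (fun _ => (h.meas measurableSet_Iio).inter measurableSet_Ico)
  refine this.congr_fun fun m => ?_
  rw [h.preimage_inter_branch m t, measureReal_Ico_eq_cum μ (h.branchInv_mem m t).1]

/-- A map with convex branches preserves the class of measures with decreasing density. -/
theorem cum_map_concave (h : IsConvexBranched T b c) {μ : Measure ℝ} [IsFiniteMeasure μ]
    (hμ : μ ≪ lebI)
    (hc : ∀ m, ConcaveOn ℝ (Icc (b (m + 1)) (b m)) (cum μ)) :
    ConcaveOn ℝ (Icc 0 1) (cum (μ.map T)) := by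
  refine ⟨convex_Icc 0 1, fun s hs t ht p q hp hq hpq => ?_⟩
  refine hasSum_le (fun m => ?_)
    (((h.hasSum_cum_map hμ s).mul_left p).add ((h.hasSum_cum_map hμ t).mul_left q))
    (h.hasSum_cum_map hμ _)
  have := (h.comp_branchInv_concave m (hc m) (cum_mono μ) (convex_Ici 0) subset_rfl
    (fun t _ => (h.branchInv_mem m t).1)).2 hs.1 ht.1 hp hq hpq
  simp only [smul_eq_mul] at this ⊢
  have e : p * (cum μ (branchInv T b m s) - cum μ (b (m + 1))) +
      q * (cum μ (branchInv T b m t) - cum μ (b (m + 1)))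
      = p * cum μ (branchInv T b m s) + q * cum μ (branchInv T b m t) - cum μ (b (m + 1)) := by
    have : q = 1 - p := by linarith
    subst this; ring
  rw [e]
  linarith

theorem cum_map_concave_of_concave (h : IsConvexBranched T b c) {μ : Measure ℝ} [IsFiniteMeasure μ]
    (hμ : μ ≪ lebI)
    (hc : ConcaveOn ℝ (Icc 0 1) (cum μ)) : ConcaveOn ℝ (Icc 0 1) (cum (μ.map T)) :=
  h.cum_map_concave hμ fun _ => hc.subset (Icc_subset_Icc (h.b_nonneg _) (h.b_le_one _))
    (convex_Icc _ _)

end IsConvexBranched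

/-! ### The Borel versions of `τ` and `τ_n` -/

theorem measurable_of_continuousOn_iUnion {ι : Type*} [Countable ι] {T : ℝ → ℝ} {s : ι → Set ℝ}
    (hs : ∀ i, MeasurableSet (s i)) (hcov : ⋃ i, s i = univ) (hT : ∀ i, ContinuousOn T (s i)) :
    Measurable T := by
  intro A hA
  have e : T ⁻¹' A = ⋃ i, Subtype.val '' ((s i).domRestrict T ⁻¹' A) := by
    ext x
    have hx : x ∈ ⋃ i, s i := hcov ▸ mem_univ x
    obtain ⟨i, hi⟩ := mem_iUnion.1 hx
    simp only [mem_preimage, mem_iUnion, mem_image, Subtype.exists, exists_and_right, exists_eq_right]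
    exact ⟨fun h => ⟨i, hi, h⟩, fun ⟨_, _, h⟩ => h⟩
  rw [e]
  exact MeasurableSet.iUnion fun i =>
    (hs i).subtype_image ((hT i).domRestrict.measurable hA)

/-- Setting the map to 0 off the open interval makes it Borel with values in `[0, 1)` and changes
only a null set. A lower slope bound from the left end point is enough, since convexity passes it on
to all later chords. -/
theorem isConvexBranched_indicator {g : ℝ → ℝ} {b c : ℕ → ℝ} (b_zero : b 0 = 1)
    (anti : Antitone b) (lim : Tendsto b atTop (𝓝 0)) (strict : ∀ m, 0 < b m → b (m + 1) < b m)
    (maps : ∀ x ∈ Ioo (0 : ℝ) 1, g x ∈ Icc (0 : ℝ) 1)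
    (cont : ∀ m, ContinuousOn g (Ico (b (m + 1)) (b m)))
    (conv : ∀ m, ConvexOn ℝ (Ico (b (m + 1)) (b m)) g)
    (zero : ∀ m, 0 < b m → g (b (m + 1)) = 0) (c_pos : ∀ m, 0 < c m)
    (slope : ∀ m, ∀ x ∈ Ico (b (m + 1)) (b m), c m * (x - b (m + 1)) ≤ g x)
    (c_last : ∀ m, 0 < b m → b (m + 1) = 0 → 1 < c m) :
    IsConvexBranched ((Ioo (0 : ℝ) 1).indicator g) b c := by
  have nonneg : ∀ m, 0 ≤ b m := fun m => anti.le_of_tendsto lim m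
  have le_one : ∀ m, b m ≤ 1 := fun m => by rw [← b_zero]; exact anti (Nat.zero_le m)
  have eqOn : ∀ m, EqOn ((Ioo (0 : ℝ) 1).indicator g) g (Ico (b (m + 1)) (b m)) := by
    intro m x hx
    have hb : 0 < b m := (nonneg (m + 1)).trans_lt (hx.1.trans_lt hx.2)
    rcases ((nonneg (m + 1)).trans hx.1).eq_or_lt with h0 | h0
    · have hb1 : b (m + 1) = 0 := le_antisymm (h0 ▸ hx.1) (nonneg _)
      subst h0
      have hz := zero m hb
      rw [hb1] at hz
      rw [hz]
      exact indicator_of_notMem (by simp) g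
    · exact indicator_of_mem (show x ∈ Ioo (0 : ℝ) 1 from ⟨h0, hx.2.trans_le (le_one m)⟩) g
  have cover : ∀ x ∈ Ioo (0 : ℝ) 1, ∃ m, x ∈ Ico (b (m + 1)) (b m) := fun x hx =>
    exists_mem_Ico_of_tendsto_zero b_zero lim hx
  have gslope : ∀ m, ∀ x ∈ Ico (b (m + 1)) (b m), ∀ y ∈ Ico (b (m + 1)) (b m), x ≤ y →
      c m * (y - x) ≤ g y - g x := by
    intro m x hx y hy hxy
    have hb : 0 < b m := (nonneg (m + 1)).trans_lt (hx.1.trans_lt hx.2)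
    have hl : b (m + 1) ∈ Ico (b (m + 1)) (b m) := ⟨le_rfl, strict m hb⟩
    rcases hxy.eq_or_lt with rfl | hxy
    · simp
    rcases hx.1.eq_or_lt with h1 | h1
    · rw [← h1, zero m hb, sub_zero]; exact slope m y hy
    · have h2 := (conv m).slope_mono_adjacent hl hy h1 hxy
      have h3 := slope m x hx
      rw [zero m hb, sub_zero] at h2
      have h4 : c m ≤ g x / (x - b (m + 1)) := by rwa [le_div_iff₀ (sub_pos.2 h1)]
      have h5 := h4.trans h2
      rwa [le_div_iff₀ (sub_pos.2 hxy)] at h5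
  refine ⟨?_, ?_, b_zero, anti, lim, strict, fun m => (cont m).congr (eqOn m),
    fun m => (conv m).congr (eqOn m).symm, ?_, c_pos, ?_, c_last⟩
  · refine measurable_of_continuousOn_iUnion
      (s := fun i : Option ℕ => i.elim (Ioo (0 : ℝ) 1)ᶜ fun m => Ico (b (m + 1)) (b m)) ?_ ?_ ?_
    · rintro (_ | m)
      · exact measurableSet_Ioo.compl
      · exact measurableSet_Ico
    · refine eq_univ_of_forall fun x => ?_
      by_cases hx : x ∈ Ioo (0 : ℝ) 1
      · obtain ⟨m, hm⟩ := cover x hx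
        exact mem_iUnion.2 ⟨some m, hm⟩
      · exact mem_iUnion.2 ⟨none, hx⟩
    · rintro (_ | m)
      · exact (continuousOn_const (c := (0 : ℝ))).congr fun x hx => indicator_of_notMem hx g
      · exact (cont m).congr (eqOn m)
  · intro x
    by_cases hx : x ∈ Ioo (0 : ℝ) 1
    · rw [indicator_of_mem hx]
      refine ⟨(maps x hx).1, ?_⟩
      obtain ⟨m, hm⟩ := cover x hx
      -- The value 1 is not attained at `x`: the branch still increases strictly up to `y`, where it
      -- is at most 1.
      obtain ⟨y, hxy, hy⟩ := exists_between hm.2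
      have hy' : y ∈ Ico (b (m + 1)) (b m) := ⟨hm.1.trans hxy.le, hy⟩
      have h1 := gslope m x hm y hy' hxy.le
      have h2 := (maps y ⟨hx.1.trans hxy, hy.trans_le (le_one m)⟩).2
      nlinarith [mul_pos (c_pos m) (sub_pos.2 hxy)]
    · rw [indicator_of_notMem hx]; simp
  · intro m hb
    rw [eqOn m ⟨le_rfl, strict m hb⟩]; exact zero m hb
  · intro m x hx y hy hxy
    rw [eqOn m hx, eqOn m hy]; exact gslope m x hx y hy hxy

/-- The slope of the `m`-th branch of `τ` at its left end point. -/
noncomputable def branchSlope (τ : ℝ → ℝ) (a : ℕ → ℝ) (m : ℕ) : ℝ :=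
  derivWithin τ (Ioi (a (m + 1))) (a (m + 1))

/-- The partition points of the approximating map `τ_n`. -/
def approxPoints (a : ℕ → ℝ) (n m : ℕ) : ℝ := if m ≤ n then a m else 0

/-- Lower bounds for the slopes of the branches of `τ_n`. -/
noncomputable def approxSlope (τ : ℝ → ℝ) (a : ℕ → ℝ) (n m : ℕ) : ℝ :=
  if m = n then 1 / a n else branchSlope τ a m

namespace IsPiecewiseConvexZero

variable {τ : ℝ → ℝ} {a : ℕ → ℝ}

theorem a_pos (hτ : IsPiecewiseConvexZero τ a) (m : ℕ) : 0 < a m :=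
  (hτ.a_anti.antitone.le_of_tendsto hτ.a_lim (m + 1)).trans_lt (hτ.a_anti (Nat.lt_succ_self m))

theorem a_le_one (hτ : IsPiecewiseConvexZero τ a) (m : ℕ) : a m ≤ 1 := by
  rw [← hτ.a_zero]; exact hτ.a_anti.antitone (Nat.zero_le m)

theorem a_lt_one (hτ : IsPiecewiseConvexZero τ a) {m : ℕ} (hm : 1 ≤ m) : a m < 1 := by
  rw [← hτ.a_zero]; exact hτ.a_anti hm

theorem branchSlope_pos (hτ : IsPiecewiseConvexZero τ a) (m : ℕ) : 0 < branchSlope τ a m :=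
  hτ.deriv_pos (m + 1) (by omega)

theorem branchSlope_mul_le (hτ : IsPiecewiseConvexZero τ a) (m : ℕ) {x : ℝ}
    (hx : x ∈ Ico (a (m + 1)) (a m)) : branchSlope τ a m * (x - a (m + 1)) ≤ τ x := by
  have hz := hτ.branch_zero (m + 1) (by omega)
  rcases hx.1.eq_or_lt with h1 | h1
  · rw [← h1, hz]; simp
  -- A positive `derivWithin` is not the default value 0, so the right derivative exists.
  · have hd : DifferentiableWithinAt ℝ τ (Ioi (a (m + 1))) (a (m + 1)) := by
      by_contra hd
      have := hτ.branchSlope_pos m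
      rw [branchSlope, derivWithin_zero_of_not_differentiableWithinAt hd] at this
      exact lt_irrefl _ this
    have := (hτ.branch_convex m).le_slope_of_hasDerivWithinAt_Ioi
      ⟨le_rfl, hτ.a_anti (Nat.lt_succ_self m)⟩ hx h1 hd.hasDerivWithinAt
    rw [slope_def_field, hz, sub_zero, le_div_iff₀ (sub_pos.2 h1)] at this
    exact this

theorem isConvexBranched (hτ : IsPiecewiseConvexZero τ a) :
    IsConvexBranched ((Ioo (0 : ℝ) 1).indicator τ) a (branchSlope τ a) :=
  isConvexBranched_indicator hτ.a_zero hτ.a_anti.antitone hτ.a_lim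
    (fun m _ => hτ.a_anti (Nat.lt_succ_self m)) (fun _ hx => hτ.mapsTo (Ioo_subset_Icc_self hx))
    hτ.branch_cont hτ.branch_convex (fun m _ => hτ.branch_zero (m + 1) (by omega))
    hτ.branchSlope_pos (fun m _ hx => hτ.branchSlope_mul_le m hx)
    (fun m _ h0 => absurd h0 (hτ.a_pos (m + 1)).ne')

theorem approx_branch_lt {n m : ℕ} (hm : m < n) :
    Ico (approxPoints a n (m + 1)) (approxPoints a n m) = Ico (a (m + 1)) (a m) := by
  simp [approxPoints, hm.le, Nat.succ_le_of_lt hm]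

theorem approx_branch_self (a : ℕ → ℝ) (n : ℕ) :
    Ico (approxPoints a n (n + 1)) (approxPoints a n n) = Ico 0 (a n) := by
  simp [approxPoints]

theorem approx_branch_gt {n m : ℕ} (hm : n < m) :
    Ico (approxPoints a n (m + 1)) (approxPoints a n m) = ∅ := by
  simp [approxPoints, hm.not_ge, (hm.trans (Nat.lt_succ_self m)).not_ge]

theorem approxMap_eqOn_lt (hτ : IsPiecewiseConvexZero τ a) {n m : ℕ} (hm : m < n) :
    EqOn (approxMap τ a n) τ (Ico (a (m + 1)) (a m)) := by
  intro x hx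
  have : a n ≤ a (m + 1) := hτ.a_anti.antitone hm
  exact if_neg (not_lt.2 (this.trans hx.1))

theorem approxMap_eqOn_self (τ : ℝ → ℝ) (a : ℕ → ℝ) (n : ℕ) :
    EqOn (approxMap τ a n) (fun x => x / a n) (Ico 0 (a n)) :=
  fun _ hx => if_pos hx.2

/-- The branches with index below `n` are those of `τ`, the `n`-th is the linear one, and later ones
are empty. The condition `1 ≤ n` makes the slope `1 / a n` of the branch at 0 exceed 1; for `n = 0`
the map would be the identity. -/
theorem approx_isConvexBranched (hτ : IsPiecewiseConvexZero τ a) {n : ℕ} (hn : 1 ≤ n) :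
    IsConvexBranched ((Ioo (0 : ℝ) 1).indicator (approxMap τ a n)) (approxPoints a n)
      (approxSlope τ a n) := by
  have han := hτ.a_pos n
  refine isConvexBranched_indicator ?_ ?_ ?_ ?_ ?_ ?_ ?_ ?_ ?_ ?_ ?_
  · simp [approxPoints, hτ.a_zero]
  · refine antitone_nat_of_succ_le fun m => ?_
    unfold approxPoints
    split_ifs with h1 h2
    · exact (hτ.a_anti (Nat.lt_succ_self m)).le
    · omega
    · exact (hτ.a_pos m).le
    · exact le_rfl
  · refine tendsto_const_nhds.congr' ?_
    filter_upwards [eventually_gt_atTop n] with m hm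
    simp [approxPoints, hm.not_ge]
  · intro m hm
    have hmn : m ≤ n := by
      by_contra hmn
      simp [approxPoints, hmn] at hm
    unfold approxPoints
    rw [if_pos hmn]
    split_ifs
    · exact hτ.a_anti (Nat.lt_succ_self m)
    · exact hτ.a_pos m
  · intro x hx
    unfold approxMap
    split_ifs with h1
    · exact ⟨div_nonneg hx.1.le han.le, (div_le_one han).2 h1.le⟩
    · exact hτ.mapsTo (Ioo_subset_Icc_self hx)
  · intro m
    rcases lt_trichotomy m n with hm | rfl | hm
    · rw [approx_branch_lt hm]; exact (hτ.branch_cont m).congr (hτ.approxMap_eqOn_lt hm)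
    · rw [approx_branch_self]
      exact (continuous_id.div_const _).continuousOn.congr (approxMap_eqOn_self τ a m)
    · rw [approx_branch_gt hm]; exact continuousOn_empty _
  · intro m
    rcases lt_trichotomy m n with hm | rfl | hm
    · rw [approx_branch_lt hm]; exact (hτ.branch_convex m).congr (hτ.approxMap_eqOn_lt hm).symm
    · rw [approx_branch_self]
      refine ConvexOn.congr ?_ (approxMap_eqOn_self τ a m).symm
      refine ⟨convex_Ico _ _, fun x _ y _ p q _ _ _ => le_of_eq ?_⟩
      simp only [smul_eq_mul]; ring
    · rw [approx_branch_gt hm]; exact ⟨convex_empty, fun x hx => absurd hx (notMem_empty x)⟩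
  · intro m hm
    have hmn : m ≤ n := by
      by_contra hmn
      simp [approxPoints, hmn] at hm
    rcases hmn.lt_or_eq with hmn | rfl
    · have : approxPoints a n (m + 1) = a (m + 1) := if_pos hmn
      rw [this, hτ.approxMap_eqOn_lt hmn ⟨le_rfl, hτ.a_anti (Nat.lt_succ_self m)⟩]
      exact hτ.branch_zero (m + 1) (by omega)
    · have : approxPoints a m (m + 1) = 0 := if_neg (by omega)
      rw [this, approxMap_eqOn_self τ a m ⟨le_rfl, han⟩]
      exact zero_div _
  · intro m
    unfold approxSlope
    split_ifs
    · positivity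
    · exact hτ.branchSlope_pos m
  · intro m x hx
    rcases lt_trichotomy m n with hm | rfl | hm
    · have e : approxPoints a n (m + 1) = a (m + 1) := if_pos hm
      rw [approx_branch_lt hm] at hx
      rw [e, hτ.approxMap_eqOn_lt hm hx, approxSlope, if_neg hm.ne]
      exact hτ.branchSlope_mul_le m hx
    · have e : approxPoints a m (m + 1) = 0 := if_neg (by omega)
      rw [approx_branch_self] at hx
      rw [e, approxMap_eqOn_self τ a m hx, approxSlope, if_pos rfl]
      exact le_of_eq (by ring)
    · rw [approx_branch_gt hm] at hx; exact absurd hx (notMem_empty x)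
  · intro m hm h0
    have hmn : n < m + 1 := by
      by_contra hmn
      rw [approxPoints, if_pos (by omega)] at h0
      exact (hτ.a_pos _).ne' h0
    have hmn' : m ≤ n := by
      by_contra hmn
      simp [approxPoints, hmn] at hm
    have : m = n := by omega
    subst this
    rw [approxSlope, if_pos rfl]
    exact (one_lt_div han).2 (hτ.a_lt_one hn)

end IsPiecewiseConvexZero

/-! ### Cells, step functions and their measures -/

theorem lebI_real_Ico {x y : ℝ} (hx : 0 ≤ x) (hxy : x ≤ y) (hy : y ≤ 1) :
    lebI.real (Ico x y) = y - x := by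
  rw [lebI, measureReal_restrict_apply measurableSet_Ico, inter_eq_left.2, Real.volume_real_Ico,
    max_eq_left (sub_nonneg.2 hxy)]
  exact fun z hz => ⟨hx.trans hz.1, hz.2.le.trans hy⟩

section Cells

variable {k : ℕ}

theorem cell_left_nonneg (i : Fin k) : (0 : ℝ) ≤ (i : ℝ) / k := by positivity

theorem cell_lt (hk : 1 ≤ k) (i : Fin k) : (i : ℝ) / k < ((i : ℝ) + 1) / k := by
  have : (0 : ℝ) < k := by exact_mod_cast hk
  gcongr
  linarith

theorem cell_right_le (i : Fin k) : ((i : ℝ) + 1) / k ≤ 1 := by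
  have h0 : 0 < k := i.pos
  have h1 : (0 : ℝ) < k := by exact_mod_cast h0
  rw [div_le_one h1]
  exact_mod_cast i.isLt

theorem measurableSet_cell (i : Fin k) : MeasurableSet (cell k i) := measurableSet_Ico

theorem lebI_real_cell (i : Fin k) : lebI.real (cell k i) = 1 / k := by
  have h0 : 0 < k := i.pos
  rw [cell, lebI_real_Ico (cell_left_nonneg i) (cell_lt h0 i).le (cell_right_le i)]
  ring

theorem cell_subset (i : Fin k) : cell k i ⊆ Ico 0 1 := fun _ hx =>
  ⟨(cell_left_nonneg i).trans hx.1, hx.2.trans_le (cell_right_le i)⟩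

theorem le_of_mem_cell {i j : Fin k} {x y : ℝ} (hx : x ∈ cell k i) (hy : y ∈ cell k j)
    (hxy : x ≤ y) : i ≤ j := by
  have h0 : 0 < k := i.pos
  have h1 : (0 : ℝ) < k := by exact_mod_cast h0
  have h2 : (i : ℝ) / k < ((j : ℝ) + 1) / k := hx.1.trans_lt (hxy.trans_lt hy.2)
  rw [div_lt_div_iff_of_pos_right h1] at h2
  have h3 : (i : ℕ) < (j : ℕ) + 1 := by exact_mod_cast h2
  exact Fin.le_def.2 (by omega)

theorem eq_of_mem_cell {i j : Fin k} {x : ℝ} (hi : x ∈ cell k i) (hj : x ∈ cell k j) : i = j :=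
  le_antisymm (le_of_mem_cell hi hj le_rfl) (le_of_mem_cell hj hi le_rfl)

theorem exists_cell (hk : 1 ≤ k) {x : ℝ} (hx : x ∈ Ico (0 : ℝ) 1) : ∃ i, x ∈ cell k i := by
  have h1 : (0 : ℝ) < k := by exact_mod_cast hk
  have hxk : 0 ≤ x * k := mul_nonneg hx.1 h1.le
  have hlt : ⌊x * k⌋₊ < k := by
    rw [Nat.floor_lt hxk]
    nlinarith [hx.2]
  refine ⟨⟨⌊x * k⌋₊, hlt⟩, ?_, ?_⟩
  · rw [div_le_iff₀ h1]; exact Nat.floor_le hxk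
  · rw [lt_div_iff₀ h1]; exact Nat.lt_floor_add_one _

theorem iUnion_cell (hk : 1 ≤ k) : ⋃ i, cell k i = Ico (0 : ℝ) 1 :=
  Subset.antisymm (iUnion_subset cell_subset) fun _ hx => mem_iUnion.2 (exists_cell hk hx)

theorem disjoint_cells : Pairwise (Function.onFun Disjoint (cell k)) := fun _ _ hij =>
  Set.disjoint_left.2 fun _ hi hj => hij (eq_of_mem_cell hi hj)

theorem stepFn_of_mem (v : Fin k → ℝ) {i : Fin k} {x : ℝ} (hx : x ∈ cell k i) :
    stepFn k v x = v i := by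
  rw [stepFn, Finset.sum_eq_single i]
  · exact indicator_of_mem hx _
  · intro j _ hj
    exact indicator_of_notMem (fun h => hj (eq_of_mem_cell h hx)) _
  · simp

theorem stepFn_of_notMem (v : Fin k → ℝ) {x : ℝ} (hx : x ∉ Ico (0 : ℝ) 1) :
    stepFn k v x = 0 :=
  Finset.sum_eq_zero fun i _ => indicator_of_notMem (fun h => hx (cell_subset i h)) _

theorem stepFn_nonneg {v : Fin k → ℝ} (hv : ∀ i, 0 ≤ v i) (x : ℝ) : 0 ≤ stepFn k v x :=
  Finset.sum_nonneg fun i _ => indicator_nonneg (fun _ _ => hv i) x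

theorem stepFn_antitoneOn {v : Fin k → ℝ} (hv : ∀ i, 0 ≤ v i) (ha : Antitone v) :
    AntitoneOn (stepFn k v) (Ici 0) := by
  intro x hx y _ hxy
  by_cases hy : y < 1
  · rcases Nat.eq_zero_or_pos k with rfl | hk
    · simp [stepFn]
    obtain ⟨i, hi⟩ := exists_cell hk ⟨hx, hxy.trans_lt hy⟩
    obtain ⟨j, hj⟩ := exists_cell hk ⟨le_trans hx hxy, hy⟩
    rw [stepFn_of_mem v hi, stepFn_of_mem v hj]
    exact ha (le_of_mem_cell hi hj hxy)
  · rw [stepFn_of_notMem v (fun h => hy h.2)]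
    exact stepFn_nonneg hv x

theorem sum_lebI_inter_cell (hk : 1 ≤ k) {A : Set ℝ} (hA : MeasurableSet A) :
    ∑ i, lebI.real (A ∩ cell k i) = lebI.real A := by
  rw [← measureReal_iUnion_fintype
    (fun i j hij => (disjoint_cells hij).mono inter_subset_right inter_subset_right)
    (fun i => hA.inter (measurableSet_cell i)), ← inter_iUnion, iUnion_cell hk]
  refine measureReal_congr ?_
  filter_upwards [ae_lebI_mem_Ioo] with x hx
  exact propext ⟨fun h => h.1, fun h => ⟨h, hx.1.le, hx.2⟩⟩

/-- The measure with density `stepFn k v`. -/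
noncomputable def stepMeas (k : ℕ) (v : Fin k → ℝ) : Measure ℝ :=
  ∑ i, ENNReal.ofReal (v i) • lebI.restrict (cell k i)

instance (v : Fin k → ℝ) : IsFiniteMeasure (stepMeas k v) := by
  unfold stepMeas
  refine ⟨?_⟩
  rw [Measure.finsetSum_apply]
  refine ENNReal.sum_lt_top.2 fun i _ => ?_
  rw [Measure.smul_apply, smul_eq_mul]
  exact ENNReal.mul_lt_top ENNReal.ofReal_lt_top (measure_lt_top _ _)

theorem stepMeas_ac (v : Fin k → ℝ) : stepMeas k v ≪ lebI := by
  refine Measure.AbsolutelyContinuous.mk fun s _ h0 => ?_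
  rw [stepMeas, Measure.finsetSum_apply]
  refine Finset.sum_eq_zero fun i _ => ?_
  rw [Measure.smul_apply, Measure.restrict_le_self.absolutelyContinuous h0, smul_zero]

theorem stepMeas_real {v : Fin k → ℝ} (hv : ∀ i, 0 ≤ v i) {A : Set ℝ} (hA : MeasurableSet A) :
    (stepMeas k v).real A = ∑ i, v i * lebI.real (A ∩ cell k i) := by
  rw [Measure.real, stepMeas, Measure.finsetSum_apply, ENNReal.toReal_sum]
  · refine Finset.sum_congr rfl fun i _ => ?_
    rw [Measure.smul_apply, smul_eq_mul, ENNReal.toReal_mul, ENNReal.toReal_ofReal (hv i),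
      Measure.restrict_apply hA]
    rfl
  · intro i _
    rw [Measure.smul_apply, smul_eq_mul]
    exact ENNReal.mul_ne_top ENNReal.ofReal_ne_top (measure_ne_top _ _)

theorem setIntegral_stepFn (v : Fin k → ℝ) (A : Set ℝ) :
    ∫ x in A, stepFn k v x ∂lebI = ∑ i, v i * lebI.real (A ∩ cell k i) := by
  unfold stepFn
  rw [integral_finsetSum]
  · refine Finset.sum_congr rfl fun i _ => ?_
    rw [integral_indicator (measurableSet_cell i), setIntegral_const, smul_eq_mul, mul_comm,
      measureReal_restrict_apply (measurableSet_cell i), inter_comm]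
  · intro i _
    exact ((integrable_const (v i)).indicator (measurableSet_cell i)).integrableOn

theorem setIntegral_stepFn_eq {v : Fin k → ℝ} (hv : ∀ i, 0 ≤ v i) {A : Set ℝ}
    (hA : MeasurableSet A) : ∫ x in A, stepFn k v x ∂lebI = (stepMeas k v).real A := by
  rw [setIntegral_stepFn v A, stepMeas_real hv hA]

theorem norm_stepL1 {v : Fin k → ℝ} (hv : ∀ i, 0 ≤ v i) : ‖stepL1 k v‖ = (∑ i, v i) / k := by
  have h1 : ∫ x, ‖stepL1 k v x‖ ∂lebI = ∫ x in univ, stepFn k v x ∂lebI := by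
    rw [setIntegral_univ]
    refine integral_congr_ae ?_
    filter_upwards [(memLp_stepFn k v).coeFn_toLp] with x hx
    rw [stepL1, hx, Real.norm_of_nonneg (stepFn_nonneg hv x)]
  rw [L1.norm_eq_integral_norm, h1, setIntegral_stepFn v univ, Finset.sum_div]
  refine Finset.sum_congr rfl fun i _ => ?_
  rw [univ_inter, lebI_real_cell]
  ring

/-- With its companion below: the mean of a decreasing step function over `[x, y)` lies between its
values at `y` and `x`. These two bounds are the only way in which monotonicity enters concavity, the
bound `1/x` and pointwise convergence. -/
theorem stepMeas_Ico_le {v : Fin k → ℝ} (hk : 1 ≤ k) (hv : ∀ i, 0 ≤ v i) (ha : Antitone v)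
    {x y : ℝ} (hx : 0 ≤ x) (hxy : x ≤ y) (hy : y ≤ 1) :
    (stepMeas k v).real (Ico x y) ≤ stepFn k v x * (y - x) := by
  rw [stepMeas_real hv measurableSet_Ico, ← lebI_real_Ico hx hxy hy,
    ← sum_lebI_inter_cell hk measurableSet_Ico, Finset.mul_sum]
  refine Finset.sum_le_sum fun i _ => ?_
  rcases (Ico x y ∩ cell k i).eq_empty_or_nonempty with h0 | ⟨z, hz, hzi⟩
  · simp [h0]
  · refine mul_le_mul_of_nonneg_right ?_ measureReal_nonneg
    rw [← stepFn_of_mem v hzi]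
    exact stepFn_antitoneOn hv ha hx (hx.trans hz.1) hz.1

theorem le_stepMeas_Ico {v : Fin k → ℝ} (hk : 1 ≤ k) (hv : ∀ i, 0 ≤ v i) (ha : Antitone v)
    {x y : ℝ} (hx : 0 ≤ x) (hxy : x ≤ y) (hy : y ≤ 1) :
    stepFn k v y * (y - x) ≤ (stepMeas k v).real (Ico x y) := by
  rw [stepMeas_real hv measurableSet_Ico, ← lebI_real_Ico hx hxy hy,
    ← sum_lebI_inter_cell hk measurableSet_Ico, Finset.mul_sum]
  refine Finset.sum_le_sum fun i _ => ?_
  rcases (Ico x y ∩ cell k i).eq_empty_or_nonempty with h0 | ⟨z, hz, hzi⟩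
  · simp [h0]
  · refine mul_le_mul_of_nonneg_right ?_ measureReal_nonneg
    rw [← stepFn_of_mem v hzi]
    exact stepFn_antitoneOn hv ha (hx.trans hz.1) (hx.trans hxy) hz.2.le

theorem cum_stepMeas_concave {v : Fin k → ℝ} (hk : 1 ≤ k) (hv : ∀ i, 0 ≤ v i)
    (ha : Antitone v) : ConcaveOn ℝ (Icc 0 1) (cum (stepMeas k v)) := by
  refine concaveOn_of_slope_anti_adjacent (convex_Icc 0 1) fun {x y z} hx hz hxy hyz => ?_
  rw [← measureReal_Ico_eq_cum _ hyz.le, ← measureReal_Ico_eq_cum _ hxy.le]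
  have h1 := stepMeas_Ico_le hk hv ha (hx.1.trans hxy.le) hyz.le hz.2
  have h2 := le_stepMeas_Ico hk hv ha hx.1 hxy.le (hyz.le.trans hz.2)
  calc _ ≤ stepFn k v y := by rw [div_le_iff₀ (sub_pos.2 hyz)]; exact h1
    _ ≤ _ := by rw [le_div_iff₀ (sub_pos.2 hxy)]; exact h2

end Cells

/-! ### The Ulam operator and a decreasing fixed vector -/

/-- A continuous linear map that preserves a nonempty compact convex set has a fixed point there. -/
theorem exists_fixedPoint_of_isCompact_convex {E : Type*} [NormedAddCommGroup E]
    [NormedSpace ℝ E] (L : E →L[ℝ] E) {S : Set E} (hc : IsCompact S) (hconv : Convex ℝ S)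
    (hne : S.Nonempty) (hL : MapsTo L S S) : ∃ x ∈ S, L x = x := by
  obtain ⟨x₀, hx₀⟩ := hne
  have hit : ∀ j, L^[j] x₀ ∈ S := fun j => hL.iterate j hx₀
  -- Cesàro means of an orbit are almost fixed: the defect telescopes to `(L^[N+1] x₀ - x₀) / (N +
  -- 1)`, which tends to 0 because `S` is bounded. Any limit point of the means is then fixed.
  set y : ℕ → E := fun N => ∑ j ∈ Finset.range (N + 1), ((N : ℝ) + 1)⁻¹ • L^[j] x₀ with hy
  have hyS : ∀ N, y N ∈ S := fun N => by
    refine hconv.sum_mem (fun _ _ => by positivity) ?_ fun j _ => hit j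
    rw [Finset.sum_const, Finset.card_range, nsmul_eq_mul]
    push_cast
    field_simp
  have hdiff : ∀ N, L (y N) - y N = ((N : ℝ) + 1)⁻¹ • (L^[N + 1] x₀ - x₀) := fun N => by
    simp only [hy, map_sum, map_smul, ← Finset.smul_sum, ← smul_sub, ← Finset.sum_sub_distrib]
    congr 1
    have : ∀ j, L (L^[j] x₀) = L^[j + 1] x₀ := fun j => (Function.iterate_succ_apply' L j x₀).symm
    simp only [this]
    exact Finset.sum_range_sub (fun j => L^[j] x₀) (N + 1)
  obtain ⟨x, hxS, φ, hφ, hlim⟩ := hc.tendsto_subseq hyS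
  refine ⟨x, hxS, ?_⟩
  obtain ⟨R, hR⟩ := hc.isBounded.exists_norm_le
  have h0 : Tendsto (fun N => L (y N) - y N) atTop (𝓝 0) := by
    rw [tendsto_zero_iff_norm_tendsto_zero]
    have hb : Tendsto (fun N : ℕ => ((N : ℝ) + 1)⁻¹ * (R + R)) atTop (𝓝 0) := by
      have := (tendsto_one_div_add_atTop_nhds_zero_nat (𝕜 := ℝ)).mul_const (R + R)
      simpa [one_div] using this
    refine squeeze_zero (fun _ => norm_nonneg _) (fun N => ?_) hb
    rw [hdiff, norm_smul, Real.norm_of_nonneg (by positivity)]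
    refine mul_le_mul_of_nonneg_left ?_ (by positivity)
    exact (norm_sub_le _ _).trans (add_le_add (hR _ (hit _)) (hR _ hx₀))
  have h1 := (L.continuous.tendsto x).comp hlim |>.sub hlim
  exact sub_eq_zero.1 (tendsto_nhds_unique h1 (h0.comp hφ.tendsto_atTop))

section Ulam

variable {T : ℝ → ℝ} {k : ℕ}

theorem ulamMatrix_congr {T' : ℝ → ℝ} (h : T =ᵐ[lebI] T') (k : ℕ) :
    ulamMatrix T k = ulamMatrix T' k := by
  ext i j
  simp only [ulamMatrix, Matrix.of_apply]
  congr 1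
  refine measureReal_congr ?_
  filter_upwards [h] with x hx
  exact propext (and_congr_left fun _ => by simp only [mem_preimage, hx])

theorem indicator_ae_eq (g : ℝ → ℝ) : g =ᵐ[lebI] (Ioo (0 : ℝ) 1).indicator g := by
  filter_upwards [ae_lebI_mem_Ioo] with x hx
  exact (indicator_of_mem hx g).symm

theorem isUlamDensity_congr {T' : ℝ → ℝ} (h : T =ᵐ[lebI] T') (v : Fin k → ℝ) :
    IsUlamDensity T k v ↔ IsUlamDensity T' k v := by
  simp only [IsUlamDensity, ulamOp, ulamMatrix_congr h]

theorem ulamMatrix_nonneg (T : ℝ → ℝ) (i j : Fin k) : 0 ≤ ulamMatrix T k i j :=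
  div_nonneg measureReal_nonneg measureReal_nonneg

theorem ulamMatrix_row_sum (hk : 1 ≤ k) (hm : Measurable T) (hT : ∀ x, T x ∈ Ico (0 : ℝ) 1)
    (i : Fin k) : ∑ j, ulamMatrix T k i j = 1 := by
  simp only [ulamMatrix, Matrix.of_apply]
  have hk' : (0 : ℝ) < k := by exact_mod_cast hk
  rw [← Finset.sum_div, ← measureReal_iUnion_fintype
    (fun j l hjl => ((disjoint_cells hjl).preimage T).mono inter_subset_left inter_subset_left)
    (fun j => (hm (measurableSet_cell j)).inter (measurableSet_cell i)), ← iUnion_inter,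
    ← preimage_iUnion, iUnion_cell hk, preimage_eq_univ_iff.2, univ_inter, div_self]
  · rw [lebI_real_cell]; positivity
  · rintro _ ⟨x, rfl⟩; exact hT x

/-- The Ulam operator is the push-forward of the step measure followed by averaging over cells of
length `1/k`. -/
theorem ulamOp_apply (hm : Measurable T) {v : Fin k → ℝ} (hv : ∀ i, 0 ≤ v i) (j : Fin k) :
    ulamOp T k v j = k * (stepMeas k v).real (T ⁻¹' cell k j) := by
  rw [stepMeas_real hv (hm (measurableSet_cell j)), ulamOp, Matrix.vecMul, dotProduct,
    Finset.mul_sum]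
  refine Finset.sum_congr rfl fun i _ => ?_
  rw [ulamMatrix, Matrix.of_apply, lebI_real_cell]
  have : (k : ℝ) ≠ 0 := by exact_mod_cast i.pos.ne'
  field_simp

theorem ulamOp_nonneg {v : Fin k → ℝ} (hv : ∀ i, 0 ≤ v i) (j : Fin k) : 0 ≤ ulamOp T k v j := by
  simp only [ulamOp, Matrix.vecMul, dotProduct]
  exact Finset.sum_nonneg fun i _ => mul_nonneg (hv i) (ulamMatrix_nonneg T i j)

theorem sum_ulamOp (hk : 1 ≤ k) (hm : Measurable T) (hT : ∀ x, T x ∈ Ico (0 : ℝ) 1)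
    (v : Fin k → ℝ) : ∑ j, ulamOp T k v j = ∑ i, v i := by
  simp only [ulamOp, Matrix.vecMul, dotProduct]
  rw [Finset.sum_comm]
  refine Finset.sum_congr rfl fun i _ => ?_
  rw [← Finset.mul_sum, ulamMatrix_row_sum hk hm hT, mul_one]

variable {b c : ℕ → ℝ}

/-- The entries are `k` times the increments of a concave function over consecutive intervals of
equal length. -/
theorem IsConvexBranched.ulamOp_antitone (h : IsConvexBranched T b c) {v : Fin k → ℝ}
    (hk : 1 ≤ k) (hv : ∀ i, 0 ≤ v i) (ha : Antitone v) : Antitone (ulamOp T k v) := by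
  have hG := h.cum_map_concave_of_concave (stepMeas_ac v) (cum_stepMeas_concave hk hv ha)
  obtain ⟨k, rfl⟩ := Nat.exists_eq_succ_of_ne_zero (by omega : k ≠ 0)
  have e : ∀ j, ulamOp T (k + 1) v j = (k + 1 : ℕ) *
      (cum ((stepMeas (k + 1) v).map T) (((j : ℝ) + 1) / (k + 1 : ℕ)) -
        cum ((stepMeas (k + 1) v).map T) ((j : ℝ) / (k + 1 : ℕ))) := fun j => by
    rw [ulamOp_apply h.meas hv, ← map_measureReal_apply h.meas (measurableSet_cell j), cell,
      measureReal_Ico_eq_cum _ (cell_lt hk j).le]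
  refine Fin.antitone_iff_succ_le.2 fun i => ?_
  have hk' : (0 : ℝ) < (k + 1 : ℕ) := by positivity
  rw [e, e]
  have h1 := cell_lt hk i.castSucc
  have h2 := cell_lt hk i.succ
  have e1 : ((i.succ : Fin (k + 1)) : ℝ) = ((i.castSucc : Fin (k + 1)) : ℝ) + 1 := by simp
  rw [e1] at h2 ⊢
  have := hG.slope_anti_adjacent ⟨cell_left_nonneg i.castSucc, ?_⟩ ⟨?_, ?_⟩ h1 h2
  · rw [← sub_div, ← sub_div, add_sub_cancel_left, add_sub_cancel_left,
      div_le_div_iff_of_pos_right (by positivity)] at this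
    exact mul_le_mul_of_nonneg_left this hk'.le
  · exact h1.le.trans (cell_right_le i.castSucc)
  · exact (cell_left_nonneg i.castSucc).trans (h1.trans h2).le
  · rw [← e1]; exact cell_right_le i.succ

theorem IsConvexBranched.exists_antitone_ulamDensity (h : IsConvexBranched T b c)
    (hk : 1 ≤ k) : ∃ v : Fin k → ℝ, IsUlamDensity T k v ∧ Antitone v := by
  -- The total `k` corresponds to `L¹` norm 1, as each cell has length `1/k`.
  set S : Set (Fin k → ℝ) := {v | (∀ i, 0 ≤ v i) ∧ Antitone v ∧ ∑ i, v i = k}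
  have hk' : (0 : ℝ) < k := by exact_mod_cast hk
  have hclosed : IsClosed S := by
    have h1 : IsClosed {v : Fin k → ℝ | ∀ i, 0 ≤ v i} := by
      simp only [ofPred_forall]
      exact isClosed_iInter fun i => isClosed_le continuous_const (continuous_apply i)
    have h2 : IsClosed {v : Fin k → ℝ | Antitone v} := by
      simp only [Antitone, ofPred_forall]
      exact isClosed_iInter fun i => isClosed_iInter fun j => isClosed_iInter fun _ =>
        isClosed_le (continuous_apply j) (continuous_apply i)
    have h3 : IsClosed {v : Fin k → ℝ | ∑ i, v i = k} :=
      isClosed_eq (continuous_finsetSum _ fun i _ => continuous_apply i) continuous_const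
    exact h1.inter (h2.inter h3)
  have hsub : S ⊆ Icc (fun _ => 0) (fun _ => (k : ℝ)) := fun v hv =>
    ⟨fun i => hv.1 i, fun i => by
      rw [← hv.2.2]
      exact Finset.single_le_sum (f := v) (fun j _ => hv.1 j) (Finset.mem_univ i)⟩
  have hcomp : IsCompact S := isCompact_Icc.of_isClosed_subset hclosed hsub
  have hconv : Convex ℝ S := by
    rintro u ⟨hu1, hu2, hu3⟩ w ⟨hw1, hw2, hw3⟩ p q hp hq hpq
    refine ⟨fun i => ?_, fun i j hij => ?_, ?_⟩
    · simp only [Pi.add_apply, Pi.smul_apply, smul_eq_mul]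
      exact add_nonneg (mul_nonneg hp (hu1 i)) (mul_nonneg hq (hw1 i))
    · simp only [Pi.add_apply, Pi.smul_apply, smul_eq_mul]
      exact add_le_add (mul_le_mul_of_nonneg_left (hu2 hij) hp)
        (mul_le_mul_of_nonneg_left (hw2 hij) hq)
    · simp only [Pi.add_apply, Pi.smul_apply, smul_eq_mul, Finset.sum_add_distrib,
        ← Finset.mul_sum, hu3, hw3]
      rw [← add_mul, hpq, one_mul]
  have hne : S.Nonempty := ⟨fun _ => 1, fun _ => zero_le_one, fun _ _ _ => le_rfl, by simp⟩
  obtain ⟨v, ⟨hv1, hv2, hv3⟩, hfix⟩ := exists_fixedPoint_of_isCompact_convex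
    (ulamMatrix T k).vecMulLinear.toContinuousLinearMap hcomp hconv hne (by
      rintro v ⟨hv1, hv2, hv3⟩
      exact ⟨ulamOp_nonneg hv1, h.ulamOp_antitone hk hv1 hv2,
        (sum_ulamOp hk h.meas h.maps v).trans hv3⟩)
  refine ⟨v, ⟨hv1, hfix, ?_⟩, hv2⟩
  rw [norm_stepL1 hv1, hv3, div_self (ne_of_gt hk')]

/-- Mass moves along the orbits of `T`: the support of a stationary vector is forward invariant. -/
theorem IsConvexBranched.pos_of_pos (h : IsConvexBranched T b c) {v : Fin k → ℝ}
    (hv : ∀ i, 0 ≤ v i) (hfix : ulamOp T k v = v) {m : ℕ} {x : ℝ}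
    (hx : x ∈ Ico (b (m + 1)) (b m)) {i j : Fin k} (hi : x ∈ cell k i) (hj : T x ∈ cell k j)
    (hpos : 0 < v i) : 0 < v j := by
  have hc : ContinuousWithinAt T (Ico x (b m)) x :=
    (h.cont m x hx).mono (Ico_subset_Ico_left hx.1)
  have he : ∀ᶠ y in 𝓝[Ico x (b m)] x, T y < ((j : ℝ) + 1) / k := hc (gt_mem_nhds hj.2)
  rw [nhdsWithin_Ico_eq_nhdsGE hx.2] at he
  obtain ⟨z, hz, hsub⟩ := (mem_nhdsGE_iff_exists_Ico_subset' hx.2).1 he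
  -- By right continuity and monotonicity, the whole interval `[x, w)` stays in the cell of `x` and
  -- is mapped into the cell of `T x`; it has positive length, so the matrix entry is positive.
  set w := min z (min (b m) (((i : ℝ) + 1) / k))
  have hxw : x < w := lt_min hz (lt_min hx.2 hi.2)
  have hw1 : w ≤ 1 := (min_le_right _ _).trans ((min_le_right _ _).trans (cell_right_le i))
  have hx0 : 0 ≤ x := (cell_subset i hi).1
  have hsub2 : Ico x w ⊆ T ⁻¹' cell k j ∩ cell k i := by
    intro y hy
    have hyb : y < b m := hy.2.trans_le ((min_le_right _ _).trans (min_le_left _ _))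
    refine ⟨⟨?_, hsub ⟨hy.1, hy.2.trans_le (min_le_left _ _)⟩⟩, hi.1.trans hy.1,
      hy.2.trans_le ((min_le_right _ _).trans (min_le_right _ _))⟩
    exact hj.1.trans ((h.strictMonoOn m).monotoneOn hx ⟨hx.1.trans hy.1, hyb⟩ hy.1)
  have hM : 0 < ulamMatrix T k i j := by
    refine div_pos ?_ ?_
    · refine lt_of_lt_of_le ?_ (measureReal_mono hsub2)
      rw [lebI_real_Ico hx0 hxw.le hw1]
      exact sub_pos.2 hxw
    · rw [lebI_real_cell]
      have : (0 : ℝ) < k := by exact_mod_cast i.pos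
      positivity
  rw [← hfix]
  refine (mul_pos hpos hM).trans_le ?_
  exact Finset.single_le_sum (f := fun i => v i * ulamMatrix T k i j)
    (fun l _ => mul_nonneg (hv l) (ulamMatrix_nonneg T l j)) (Finset.mem_univ i)

end Ulam

/-! ### Uniqueness of the fixed vector -/

section Uniqueness

variable {T : ℝ → ℝ} {k : ℕ} {b c : ℕ → ℝ}

theorem mem_cell_floor {x : ℝ} (hx : 0 ≤ x) (hn : ⌊x * k⌋₊ < k) :
    x ∈ cell k ⟨⌊x * k⌋₊, hn⟩ := by
  have h1 : (0 : ℝ) < k := by exact_mod_cast (Nat.zero_le _).trans_lt hn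
  constructor
  · rw [div_le_iff₀ h1]; exact Nat.floor_le (mul_nonneg hx h1.le)
  · rw [lt_div_iff₀ h1]; exact Nat.lt_floor_add_one _

theorem mem_Ico_of_stepFn_pos {v : Fin k → ℝ} {x : ℝ} (hx : 0 < stepFn k v x) :
    x ∈ Ico (0 : ℝ) 1 := by
  by_contra h
  rw [stepFn_of_notMem v h] at hx
  exact lt_irrefl _ hx

theorem IsConvexBranched.stepFn_pos_map (h : IsConvexBranched T b c) {v : Fin k → ℝ}
    (hk : 1 ≤ k) (hv : ∀ i, 0 ≤ v i) (hfix : ulamOp T k v = v) {m : ℕ} {x : ℝ}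
    (hx : x ∈ Ico (b (m + 1)) (b m)) (hpos : 0 < stepFn k v x) : 0 < stepFn k v (T x) := by
  obtain ⟨i, hi⟩ := exists_cell hk (mem_Ico_of_stepFn_pos hpos)
  obtain ⟨j, hj⟩ := exists_cell hk (h.maps x)
  rw [stepFn_of_mem v hi] at hpos
  rw [stepFn_of_mem v hj]
  exact h.pos_of_pos hv hfix hx hi hj hpos

/-- If the support of a stationary vector contains the cells of `[p/k, q/k)` but not the first
cell, it contains the cells of another such interval with a larger ratio of its end points, or
the same ratio and a larger right end point. -/
theorem IsConvexBranched.exists_longer_support (h : IsConvexBranched T b c) {v : Fin k → ℝ}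
    (hk : 1 ≤ k) (hv : ∀ i, 0 ≤ v i) (hfix : ulamOp T k v = v) (h0 : stepFn k v 0 = 0) {p q : ℕ}
    (hpq : p < q) (hqk : q ≤ k) (hS : ∀ x ∈ Ico ((p : ℝ) / k) ((q : ℝ) / k), 0 < stepFn k v x) :
    ∃ p' q' : ℕ, p' < q' ∧ q' ≤ k ∧
      (∀ x ∈ Ico ((p' : ℝ) / k) ((q' : ℝ) / k), 0 < stepFn k v x) ∧
      ((q : ℝ) / p < (q' : ℝ) / p' ∨ (q : ℝ) / p = (q' : ℝ) / p' ∧ q < q') := by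
  have hk0 : (0 : ℝ) < k := by exact_mod_cast hk
  have hpqR : (p : ℝ) < q := by exact_mod_cast hpq
  have hqkR : (q : ℝ) ≤ k := by exact_mod_cast hqk
  have hdiv : (p : ℝ) / k < (q : ℝ) / k := by gcongr
  have hq1 : (q : ℝ) / k ≤ 1 := (div_le_one hk0).2 hqkR
  have hp0 : (0 : ℝ) < p := by
    have hp : p ≠ 0 := by
      rintro rfl
      have := hS 0 ⟨by simp, by simpa using hdiv⟩
      linarith
    exact_mod_cast Nat.pos_of_ne_zero hp
  have hpk : (p : ℝ) / k ∈ Ioo (0 : ℝ) 1 := ⟨by positivity, hdiv.trans_le hq1⟩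
  -- A partition point in the run would be mapped to 0 and would put the first cell into the
  -- support. So the run lies strictly inside one branch, to the right of its left end point `l`.
  have hno : ∀ m, 0 < b m → b (m + 1) ∉ Ico ((p : ℝ) / k) ((q : ℝ) / k) := by
    intro m hm hmem
    have := h.stepFn_pos_map hk hv hfix ⟨le_rfl, h.strict m hm⟩ (hS _ hmem)
    rw [h.zero m hm, h0] at this
    exact lt_irrefl _ this
  obtain ⟨m, hm⟩ := h.exists_branch hpk
  have hbm := h.pos_of_mem_branch hm
  have hl : b (m + 1) < (p : ℝ) / k := by
    refine lt_of_le_of_ne hm.1 fun he => hno m hbm ⟨he.ge, he ▸ hdiv⟩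
  have hr : (q : ℝ) / k ≤ b m := by
    by_contra hr
    rw [not_le] at hr
    rcases Nat.eq_zero_or_pos m with rfl | hm0
    · rw [h.b_zero] at hr; linarith
    · obtain ⟨m', rfl⟩ := Nat.exists_eq_succ_of_ne_zero hm0.ne'
      exact hno m' (hbm.trans_le (h.anti (Nat.le_succ m'))) ⟨hm.2.le, hr⟩
  have hbranch : ∀ x ∈ Ico ((p : ℝ) / k) ((q : ℝ) / k), x ∈ Ico (b (m + 1)) (b m) :=
    fun x hx => ⟨hl.le.trans hx.1, hx.2.trans_le hr⟩
  set l := b (m + 1) with hldef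
  have hl0 : 0 ≤ l := h.b_nonneg _
  have hlmem : l ∈ Ico l (b m) := ⟨le_rfl, h.strict m hbm⟩
  set s := T ((p : ℝ) / k) with hs
  have hSs : 0 < stepFn k v s := h.stepFn_pos_map hk hv hfix hm (hS _ ⟨le_rfl, hdiv⟩)
  have hs1 : s ∈ Ico (0 : ℝ) 1 := h.maps _
  have hpl : 0 < (p : ℝ) / k - l := sub_pos.2 hl
  have hs0 : 0 < s := by
    refine lt_of_le_of_ne hs1.1 fun he => ?_
    rw [← he, h0] at hSs
    exact lt_irrefl _ hSs
  -- The slope of the chord from `(l, 0)` to `(p/k, T (p/k))`; by convexity the branch lies above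
  -- this chord on the run.
  set σ := s / ((p : ℝ) / k - l) with hσ
  have hσ0 : 0 < σ := div_pos hs0 hpl
  have hσs : σ * ((p : ℝ) / k - l) = s := div_mul_cancel₀ _ hpl.ne'
  have hsec : ∀ x ∈ Ico ((p : ℝ) / k) ((q : ℝ) / k), σ * (x - l) ≤ T x := by
    intro x hx
    have h1 := (h.conv m).secant_mono hlmem hm (hbranch x hx) hl.ne'
      (hl.trans_le hx.1).ne' hx.1
    rw [h.zero m hbm, sub_zero, sub_zero] at h1
    rwa [le_div_iff₀ (sub_pos.2 (hl.trans_le hx.1))] at h1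
  have hsk : 0 ≤ s * k := mul_nonneg hs0.le hk0.le
  have hfl : (⌊s * k⌋₊ : ℝ) ≤ s * k := Nat.floor_le hsk
  have hflk : ⌊s * k⌋₊ < k := by
    rw [Nat.floor_lt hsk]
    nlinarith [hs1.2]
  -- The height of the chord at the end of the run, in units of cells. The new run goes from `⌊s *
  -- k⌋₊` to `⌈q₁⌉₊`.
  set q₁ : ℝ := σ * ((q : ℝ) / k - l) * k with hq₁
  have hq₁' : q₁ = σ * ((q : ℝ) - l * k) := by
    rw [hq₁]; field_simp
  have hsk' : s * k = σ * ((p : ℝ) - l * k) := by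
    rw [← hσs]; field_simp
  have hsq : s * k < q₁ := by
    rw [hq₁', hsk']
    exact mul_lt_mul_of_pos_left (by linarith) hσ0
  have hce : q₁ ≤ (⌈q₁⌉₊ : ℝ) := Nat.le_ceil _
  -- The first of these cells contains `T (p/k)`; the left end point of each later one is a value of
  -- `T` on the run, by the intermediate value theorem.
  have key : ∀ n : ℕ, ⌊s * k⌋₊ ≤ n → n < ⌈q₁⌉₊ →
      ∃ hn : n < k, 0 < v ⟨n, hn⟩ := by
    intro n hn1 hn2
    rcases hn1.eq_or_lt with rfl | hn1
    · refine ⟨hflk, ?_⟩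
      rwa [← stepFn_of_mem v (mem_cell_floor hs0.le hflk)]
    · have hn2' : (n : ℝ) < q₁ := Nat.lt_ceil.1 hn2
      have hn3 : s * k < n := (Nat.floor_lt hsk).1 hn1
      have hn4 : l + n / k / σ < (q : ℝ) / k := by
        rw [← lt_sub_iff_add_lt', div_lt_iff₀ hσ0, div_lt_iff₀ hk0, mul_comm _ σ]
        exact hn2'
      obtain ⟨x₁, hx₁, hx₁q⟩ := exists_between (max_lt hdiv hn4)
      have hx₁p : (p : ℝ) / k < x₁ := (le_max_left _ _).trans_lt hx₁
      have hx₁n : (n : ℝ) / k ≤ T x₁ := by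
        have h1 : l + n / k / σ < x₁ := (le_max_right _ _).trans_lt hx₁
        rw [← lt_sub_iff_add_lt', div_lt_iff₀ hσ0, mul_comm] at h1
        exact h1.le.trans (hsec x₁ ⟨hx₁p.le, hx₁q⟩)
      have hcont : ContinuousOn T (Icc ((p : ℝ) / k) x₁) :=
        (h.cont m).mono fun y hy => hbranch y ⟨hy.1, hy.2.trans_lt hx₁q⟩
      have hsn : s ≤ (n : ℝ) / k := by rw [le_div_iff₀ hk0]; exact hn3.le
      obtain ⟨y, hy, hyn⟩ := intermediate_value_Icc hx₁p.le hcont ⟨hsn, hx₁n⟩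
      have hyI : y ∈ Ico ((p : ℝ) / k) ((q : ℝ) / k) := ⟨hy.1, hy.2.trans_lt hx₁q⟩
      have hSn := h.stepFn_pos_map hk hv hfix (hbranch y hyI) (hS y hyI)
      rw [hyn] at hSn
      have hnk : n < k := by
        have := (mem_Ico_of_stepFn_pos hSn).2
        rw [div_lt_one hk0] at this
        exact_mod_cast this
      refine ⟨hnk, ?_⟩
      have : (n : ℝ) / k ∈ cell k ⟨n, hnk⟩ := ⟨le_rfl, cell_lt hk ⟨n, hnk⟩⟩
      rwa [stepFn_of_mem v this] at hSn
  have hp'1 : (0 : ℝ) < ⌊s * k⌋₊ := by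
    have : ⌊s * k⌋₊ ≠ 0 := by
      intro he
      have h1 := mem_cell_floor hs0.le hflk
      have h2 : (0 : ℝ) ∈ cell k ⟨⌊s * k⌋₊, hflk⟩ := by
        constructor
        · simp [he]
        · simp only [he]; positivity
      rw [stepFn_of_mem v h1] at hSs
      rw [stepFn_of_mem v h2] at h0
      linarith
    exact_mod_cast Nat.pos_of_ne_zero this
  have hlt : ⌊s * k⌋₊ < ⌈q₁⌉₊ := by
    have : (⌊s * k⌋₊ : ℝ) < ⌈q₁⌉₊ := by linarith
    exact_mod_cast this
  refine ⟨⌊s * k⌋₊, ⌈q₁⌉₊, hlt, ?_, ?_, ?_⟩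
  · obtain ⟨hn, -⟩ := key (⌈q₁⌉₊ - 1) (by omega) (by omega)
    omega
  · intro x hx
    have hx0 : 0 ≤ x := le_trans (by positivity) hx.1
    obtain ⟨hn, hpos⟩ := key ⌊x * k⌋₊
      (Nat.le_floor (by rw [← div_le_iff₀ hk0]; exact hx.1))
      ((Nat.floor_lt (mul_nonneg hx0 hk0.le)).2 (by rw [← lt_div_iff₀ hk0]; exact hx.2))
    rwa [stepFn_of_mem v (mem_cell_floor hx0 hn)]
  · have e1 : (q : ℝ) * ⌊s * k⌋₊ ≤ q * (σ * ((p : ℝ) - l * k)) :=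
      mul_le_mul_of_nonneg_left (hsk' ▸ hfl) (by positivity)
    have e2 : (p : ℝ) * (σ * ((q : ℝ) - l * k)) ≤ p * ⌈q₁⌉₊ :=
      mul_le_mul_of_nonneg_left (hq₁' ▸ hce) hp0.le
    -- The gain in the cross product comparing the two ratios: strictly positive if `l > 0`. If `l =
    -- 0` the ratio may persist, but then the slope exceeds 1 and the right end point moves up.
    have e3 : (p : ℝ) * (σ * ((q : ℝ) - l * k)) - q * (σ * ((p : ℝ) - l * k))
        = σ * k * l * (q - p) := by ring
    rcases hl0.eq_or_lt with hl0 | hl0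
    · have e4 : σ * k * l * ((q : ℝ) - p) = 0 := by rw [← hl0]; ring
      have hσ1 : 1 < σ := by
        refine (h.c_last m hbm (hldef ▸ hl0.symm)).trans_le ?_
        rw [hσ, le_div_iff₀ hpl]
        have := h.slope m l hlmem _ hm hl.le
        rwa [h.zero m hbm, sub_zero] at this
      have hqq : (q : ℝ) < ⌈q₁⌉₊ := by
        rw [← hl0, zero_mul, sub_zero] at hq₁'
        have : (0 : ℝ) < q := hp0.trans hpqR
        nlinarith
      have hle : (q : ℝ) / p ≤ (⌈q₁⌉₊ : ℝ) / ⌊s * k⌋₊ := by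
        rw [div_le_div_iff₀ hp0 hp'1]
        linarith
      rcases hle.lt_or_eq with h1 | h1
      · exact Or.inl h1
      · exact Or.inr ⟨h1, by exact_mod_cast hqq⟩
    · left
      rw [div_lt_div_iff₀ hp0 hp'1]
      have : 0 < σ * k * l * ((q : ℝ) - p) :=
        mul_pos (mul_pos (mul_pos hσ0 hk0) hl0) (sub_pos.2 hpqR)
      linarith

/-- There are finitely many runs of charged cells, so one is maximal for the lexicographic order on
(ratio of the end points, right end point). The preceding lemma produces a larger one. -/
theorem IsConvexBranched.eq_zero_of_fixed (h : IsConvexBranched T b c) {v : Fin k → ℝ}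
    (hk : 1 ≤ k) (hv : ∀ i, 0 ≤ v i) (hfix : ulamOp T k v = v) (h0 : v ⟨0, hk⟩ = 0) : v = 0 := by
  by_contra hne
  obtain ⟨i, hi⟩ : ∃ i, v i ≠ 0 := by
    by_contra! hall
    exact hne (funext hall)
  have hi : 0 < v i := lt_of_le_of_ne (hv i) hi.symm
  have hk0 : (0 : ℝ) < k := by exact_mod_cast hk
  have h00 : stepFn k v 0 = 0 := by
    refine (stepFn_of_mem v (i := ⟨0, hk⟩) ⟨by simp, ?_⟩).trans h0
    simp only [Nat.cast_zero]
    positivity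
  classical
  set Q : Finset (ℕ × ℕ) := (Finset.range (k + 1) ×ˢ Finset.range (k + 1)).filter fun r =>
    r.1 < r.2 ∧ ∀ x ∈ Ico ((r.1 : ℝ) / k) ((r.2 : ℝ) / k), 0 < stepFn k v x
  have hmem : ∀ p q : ℕ, (p, q) ∈ Q ↔ p < q ∧ q ≤ k ∧
      ∀ x ∈ Ico ((p : ℝ) / k) ((q : ℝ) / k), 0 < stepFn k v x := by
    intro p q
    simp only [Q, Finset.mem_filter, Finset.mem_product, Finset.mem_range]
    constructor
    · rintro ⟨⟨_, h2⟩, h3, h4⟩; exact ⟨h3, by omega, h4⟩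
    · rintro ⟨h1, h2, h3⟩; exact ⟨⟨by omega, by omega⟩, h1, h3⟩
  have hQ : Q.Nonempty := by
    refine ⟨((i : ℕ), (i : ℕ) + 1), (hmem _ _).2 ⟨by omega, i.isLt, fun x hx => ?_⟩⟩
    push_cast at hx
    rwa [stepFn_of_mem v hx]
  obtain ⟨⟨p, q⟩, hpq, hmax⟩ :=
    Q.exists_max_image (fun r => toLex ((r.2 : ℝ) / r.1, r.2)) hQ
  obtain ⟨h1, h2, h3⟩ := (hmem p q).1 hpq
  obtain ⟨p', q', h1', h2', h3', h4⟩ := h.exists_longer_support hk hv hfix h00 h1 h2 h3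
  have := hmax (p', q') ((hmem _ _).2 ⟨h1', h2', h3'⟩)
  exact absurd ((Prod.Lex.toLex_lt_toLex).2 h4) (not_lt.2 this)

/-- Positivity gives that the image of the positive part dominates it; conservation of mass turns
this into equality. -/
theorem ulamOp_posPart_fixed (hk : 1 ≤ k) (hm : Measurable T)
    (hT : ∀ x, T x ∈ Ico (0 : ℝ) 1) {d : Fin k → ℝ} (hd : ulamOp T k d = d) :
    ulamOp T k (fun i => max (d i) 0) = fun i => max (d i) 0 := by
  have hle : ∀ j, max (d j) 0 ≤ ulamOp T k (fun i => max (d i) 0) j := by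
    intro j
    refine max_le ?_ (ulamOp_nonneg (fun i => le_max_right _ _) j)
    conv_lhs => rw [← hd]
    simp only [ulamOp, Matrix.vecMul, dotProduct]
    exact Finset.sum_le_sum fun i _ =>
      mul_le_mul_of_nonneg_right (le_max_left _ _) (ulamMatrix_nonneg T i j)
  have hsum := sum_ulamOp hk hm hT fun i => max (d i) 0
  funext j
  exact ((Finset.sum_eq_sum_iff_of_le fun j _ => hle j).1 hsum.symm j (Finset.mem_univ j)).symm

/-- Order the two vectors by their first entries. The positive part of the difference is then a
fixed vector vanishing on the first cell, hence zero; ordered vectors with equal sums coincide. -/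
theorem IsConvexBranched.ulamDensity_unique (h : IsConvexBranched T b c) {v w : Fin k → ℝ}
    (hk : 1 ≤ k) (hv : IsUlamDensity T k v) (hw : IsUlamDensity T k w) : v = w := by
  have hk0 : (0 : ℝ) < k := by exact_mod_cast hk
  have hsum : ∀ u : Fin k → ℝ, IsUlamDensity T k u → ∑ i, u i = k := fun u hu => by
    have := hu.2.2
    rw [norm_stepL1 hu.1, div_eq_one_iff_eq hk0.ne'] at this
    exact this
  have main : ∀ u w : Fin k → ℝ, IsUlamDensity T k u → IsUlamDensity T k w →
      u ⟨0, hk⟩ ≤ w ⟨0, hk⟩ → u = w := by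
    intro u w hu hw h0
    have hd : ulamOp T k (u - w) = u - w := by
      rw [ulamOp, Matrix.sub_vecMul]
      exact congrArg₂ _ hu.2.1 hw.2.1
    have hz := h.eq_zero_of_fixed hk (fun i => le_max_right _ _)
      (ulamOp_posPart_fixed hk h.meas h.maps hd) (max_eq_right (sub_nonpos.2 h0))
    have hle : ∀ i, u i ≤ w i := fun i => by
      have : max (u i - w i) 0 = 0 := congrFun hz i
      linarith [le_max_left (u i - w i) 0]
    funext i
    exact (Finset.sum_eq_sum_iff_of_le fun i _ => hle i).1 ((hsum u hu).trans (hsum w hw).symm) i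
      (Finset.mem_univ i)
  rcases le_total (v ⟨0, hk⟩) (w ⟨0, hk⟩) with h0 | h0
  · exact main v w hv hw h0
  · exact (main w v hw hv h0).symm

end Uniqueness

/-! ### The uniform bound -/

theorem IsConvexBranched.branchInv_sub_le {T : ℝ → ℝ} {b c : ℕ → ℝ}
    (h : IsConvexBranched T b c) (m : ℕ) {t : ℝ} (ht : 0 ≤ t) :
    branchInv T b m t - b (m + 1) ≤ t / c m := by
  rw [sub_le_iff_le_add']
  refine csSup_le ⟨_, mem_insert _ _⟩ ?_
  rintro x (rfl | ⟨hx, hxt⟩)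
  · exact le_add_of_nonneg_right (div_nonneg ht (h.c_pos m).le)
  · have hb := h.pos_of_mem_branch hx
    have := h.slope m _ ⟨le_rfl, h.strict m hb⟩ x hx hx.1
    rw [h.zero m hb, sub_zero] at this
    rw [← sub_le_iff_le_add', le_div_iff₀ (h.c_pos m)]
    linarith

theorem stepMeas_real_univ {k : ℕ} {v : Fin k → ℝ} (hv : ∀ i, 0 ≤ v i)
    (h1 : ‖stepL1 k v‖ = 1) : (stepMeas k v).real univ = 1 := by
  rw [norm_stepL1 hv] at h1
  rw [stepMeas_real hv MeasurableSet.univ, ← h1, Finset.sum_div]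
  refine Finset.sum_congr rfl fun i _ => ?_
  rw [univ_inter, lebI_real_cell]
  ring

theorem stepFn_mul_le_one {k : ℕ} (hk : 1 ≤ k) {v : Fin k → ℝ} (hv : ∀ i, 0 ≤ v i)
    (ha : Antitone v) (h1 : ‖stepL1 k v‖ = 1) {x : ℝ} (hx : x ∈ Icc (0 : ℝ) 1) :
    stepFn k v x * x ≤ 1 := by
  have := le_stepMeas_Ico hk hv ha le_rfl hx.1 hx.2
  rw [sub_zero] at this
  exact this.trans ((measureReal_mono (subset_univ _)).trans (stepMeas_real_univ hv h1).le)

theorem stepFn_le {k : ℕ} {v : Fin k → ℝ} {C : ℝ} (hC : 0 ≤ C) (hv : ∀ i, v i ≤ C) (x : ℝ) :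
    stepFn k v x ≤ C := by
  by_cases hx : x ∈ Ico (0 : ℝ) 1
  · rcases Nat.eq_zero_or_pos k with rfl | hk
    · simpa [stepFn] using hC
    obtain ⟨i, hi⟩ := exists_cell hk hx
    rw [stepFn_of_mem v hi]
    exact hv i
  · rw [stepFn_of_notMem v hx]; exact hC

/-- The contribution of the `m`-th branch to the value of the Ulam operator on the first cell. -/
theorem IsConvexBranched.branch_mass_le {T : ℝ → ℝ} {b c : ℕ → ℝ} {k : ℕ}
    (h : IsConvexBranched T b c) (hk : 1 ≤ k) {v : Fin k → ℝ} (hv : ∀ i, 0 ≤ v i)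
    (ha : Antitone v) (m : ℕ) :
    k * (cum (stepMeas k v) (branchInv T b m (1 / k)) - cum (stepMeas k v) (b (m + 1)))
      ≤ stepFn k v (b (m + 1)) / c m := by
  have hk0 : (0 : ℝ) < k := by exact_mod_cast hk
  have hmem := h.branchInv_mem m (1 / k)
  rw [← measureReal_Ico_eq_cum _ hmem.1]
  have h1 := stepMeas_Ico_le hk hv ha (h.b_nonneg (m + 1)) hmem.1
    (hmem.2.trans (h.b_le_one m))
  have h2 := h.branchInv_sub_le m (t := 1 / (k : ℝ)) (by positivity)
  calc _ ≤ k * (stepFn k v (b (m + 1)) * (1 / k / c m)) := by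
        refine mul_le_mul_of_nonneg_left (h1.trans ?_) hk0.le
        exact mul_le_mul_of_nonneg_left h2 (stepFn_nonneg hv _)
    _ = _ := by field_simp

namespace IsPiecewiseConvexZero

variable {τ : ℝ → ℝ} {a : ℕ → ℝ}

theorem existsUnique_ulamDensity (hτ : IsPiecewiseConvexZero τ a) {n k : ℕ} (hn : 1 ≤ n)
    (hk : 1 ≤ k) : ∃! v : Fin k → ℝ, IsUlamDensity (approxMap τ a n) k v := by
  simp only [isUlamDensity_congr (indicator_ae_eq (approxMap τ a n))]
  have h := hτ.approx_isConvexBranched hn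
  obtain ⟨v, hv, -⟩ := h.exists_antitone_ulamDensity hk
  exact ⟨v, hv, fun w hw => h.ulamDensity_unique hk hw hv⟩

/-- The fixed vector found among the decreasing ones is the only one. -/
theorem ulamDensity_antitone (hτ : IsPiecewiseConvexZero τ a) {n k : ℕ} (hn : 1 ≤ n)
    (hk : 1 ≤ k) {v : Fin k → ℝ} (hv : IsUlamDensity (approxMap τ a n) k v) : Antitone v := by
  rw [isUlamDensity_congr (indicator_ae_eq (approxMap τ a n))] at hv
  have h := hτ.approx_isConvexBranched hn
  obtain ⟨w, hw, ha⟩ := h.exists_antitone_ulamDensity hk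
  rwa [h.ulamDensity_unique hk hv hw]

/-- A self-bounding estimate of the largest entry: the original branches from `N` on, the first `N`
branches, and the linear branch give the three terms. -/
theorem ulamDensity_zero_le (hτ : IsPiecewiseConvexZero τ a) (N : ℕ) {n k : ℕ} (hn : 1 ≤ n)
    (hk : 1 ≤ k) {v : Fin k → ℝ} (hv : IsUlamDensity (approxMap τ a n) k v) :
    v ⟨0, hk⟩ ≤ (∑' m, 1 / branchSlope τ a (m + N)) * v ⟨0, hk⟩
      + (∑ m ∈ Finset.range N, 1 / branchSlope τ a m * (1 / a (m + 1))) + a n * v ⟨0, hk⟩ := by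
  have ha := hτ.ulamDensity_antitone hn hk hv
  have hk0 : (0 : ℝ) < k := by exact_mod_cast hk
  have han := hτ.a_pos n
  rw [isUlamDensity_congr (indicator_ae_eq (approxMap τ a n))] at hv
  have h := hτ.approx_isConvexBranched hn
  obtain ⟨hv0, hfix, hnorm⟩ := hv
  set T := (Ioo (0 : ℝ) 1).indicator (approxMap τ a n)
  set v₀ := v ⟨0, hk⟩ with hv₀
  have hvle : ∀ x, stepFn k v x ≤ v₀ := stepFn_le (hv0 _) fun i => ha (Fin.le_def.2 (Nat.zero_le _))
  have e0 : k * cum ((stepMeas k v).map T) (1 / k) = v₀ := by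
    rw [hv₀]
    conv_rhs => rw [← hfix]
    rw [ulamOp_apply h.meas hv0, cum, map_measureReal_apply h.meas measurableSet_Iio]
    congr 2
    ext x
    simp [cell, (h.maps x).1]
  have hs1 := (h.hasSum_cum_map (stepMeas_ac v) (1 / k)).mul_left (k : ℝ)
  rw [e0] at hs1
  have hsumm : Summable fun m => 1 / branchSlope τ a m := hτ.summable_inv_deriv
  -- For `m < N` the density at `a (m + 1)` is bounded by `1 / a (m + 1)`, for the others by its
  -- maximum `v₀`. This majorant is summed over all `m`, including the indices beyond `n` whose
  -- branches are empty.
  have hs2 : HasSum (fun m => if m < N then 1 / branchSlope τ a m * (1 / a (m + 1))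
      else 1 / branchSlope τ a m * v₀)
      ((∑' m, 1 / branchSlope τ a (m + N)) * v₀
        + (∑ m ∈ Finset.range N, 1 / branchSlope τ a m * (1 / a (m + 1)))) := by
    have e : ∑ m ∈ Finset.range N, 1 / branchSlope τ a m * (1 / a (m + 1))
        = ∑ m ∈ Finset.range N, if m < N then 1 / branchSlope τ a m * (1 / a (m + 1))
          else 1 / branchSlope τ a m * v₀ :=
      Finset.sum_congr rfl fun m hm => (if_pos (Finset.mem_range.1 hm)).symm
    rw [e]
    refine (hasSum_nat_add_iff N).1 ?_
    simp only [add_lt_iff_neg_right, Nat.not_lt_zero, if_false]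
    exact ((summable_nat_add_iff N).2 hsumm).hasSum.mul_right v₀
  have hs3 : HasSum (fun m => if m = n then a n * v₀ else 0) (a n * v₀) := by
    exact hasSum_ite_eq n (a n * v₀)
  refine hasSum_le (fun m => ?_) hs1 (hs2.add hs3)
  have hd := hτ.branchSlope_pos m
  have hd' : 0 ≤ 1 / branchSlope τ a m := by positivity
  have hv₀0 : 0 ≤ v₀ := hv0 _
  have ham := hτ.a_pos (m + 1)
  have hnn : 0 ≤ (if m < N then 1 / branchSlope τ a m * (1 / a (m + 1))
      else 1 / branchSlope τ a m * v₀) := by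
    split_ifs <;> positivity
  have hmass := h.branch_mass_le hk hv0 ha m
  rcases lt_trichotomy m n with hm | rfl | hm
  · have e1 : approxPoints a n (m + 1) = a (m + 1) := if_pos hm
    have e2 : approxSlope τ a n m = branchSlope τ a m := if_neg hm.ne
    rw [e2] at hmass
    rw [if_neg hm.ne, add_zero]
    refine hmass.trans ?_
    rw [div_eq_mul_one_div, mul_comm]
    split_ifs
    · refine mul_le_mul_of_nonneg_left ?_ hd'
      rw [e1, le_div_iff₀ ham]
      exact stepFn_mul_le_one hk hv0 ha hnorm ⟨ham.le, hτ.a_le_one _⟩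
    · exact mul_le_mul_of_nonneg_left (hvle _) hd'
  · have e2 : approxSlope τ a m m = 1 / a m := if_pos rfl
    rw [e2, div_div_eq_mul_div, div_one] at hmass
    rw [if_pos rfl]
    have := mul_le_mul_of_nonneg_right (hvle (approxPoints a m (m + 1))) han.le
    linarith
  · have e1 : approxPoints a n (m + 1) = 0 := if_neg (by omega)
    have e2 : approxPoints a n m = 0 := if_neg (by omega)
    have h1 := h.branchInv_mem m (1 / k)
    rw [e1, e2] at h1
    have h2 : branchInv T (approxPoints a n) m (1 / k) = 0 := le_antisymm h1.2 h1.1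
    rw [e1, h2, sub_self, mul_zero, if_neg hm.ne', add_zero]
    exact hnn

theorem exists_bound (hτ : IsPiecewiseConvexZero τ a) : ∃ C : ℝ, 0 ≤ C ∧ ∀ n k : ℕ, 1 ≤ n →
    1 ≤ k → ∀ v : Fin k → ℝ, IsUlamDensity (approxMap τ a n) k v → ∀ i, v i ≤ C := by
  have ha1 : a 1 < 1 := hτ.a_lt_one le_rfl
  have htail := tendsto_sum_nat_add fun m => 1 / branchSlope τ a m
  -- With the tail below `(1 - a 1) / 2` and `a n ≤ a 1`, the coefficients of the largest entry on
  -- the right leave `(1 - a 1) / 2` of it on the left, whatever `n` and `k`.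
  obtain ⟨N, hN⟩ := (htail.eventually (gt_mem_nhds (show 0 < (1 - a 1) / 2 by linarith))).exists
  set K := ∑ m ∈ Finset.range N, 1 / branchSlope τ a m * (1 / a (m + 1))
  have hK : 0 ≤ K := Finset.sum_nonneg fun m _ => by
    have := hτ.branchSlope_pos m
    have := hτ.a_pos (m + 1)
    positivity
  have hpos : 0 < (1 - a 1) / 2 := by linarith
  refine ⟨K / ((1 - a 1) / 2), div_nonneg hK hpos.le, fun n k hn hk v hv i => ?_⟩
  have h1 := hτ.ulamDensity_zero_le N hn hk hv
  have h2 : a n ≤ a 1 := hτ.a_anti.antitone hn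
  have h0 : 0 ≤ v ⟨0, hk⟩ := hv.1 _
  have hi : v i ≤ v ⟨0, hk⟩ := hτ.ulamDensity_antitone hn hk hv (Fin.le_def.2 (Nat.zero_le _))
  refine hi.trans ?_
  rw [le_div_iff₀ hpos]
  have h3 := mul_le_mul_of_nonneg_right hN.le h0
  have h4 := mul_le_mul_of_nonneg_right h2 h0
  linarith

end IsPiecewiseConvexZero

/-! ### Convergence and compactness of decreasing step functions -/

section Convergence

theorem integrable_Lp_lebI (f : Lp ℝ 1 lebI) : Integrable f lebI := L1.integrable_coeFn f

theorem setIntegral_Iio_eq_intervalIntegral {f : ℝ → ℝ} (hf : Integrable f lebI) (t : ℝ) :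
    ∫ x in Iio t, f x ∂lebI = (∫ x in Iic 0, (Icc (0 : ℝ) 1).indicator f x)
      + ∫ x in (0 : ℝ)..t, (Icc (0 : ℝ) 1).indicator f x := by
  have hg : Integrable ((Icc (0 : ℝ) 1).indicator f) volume :=
    (integrable_indicator_iff measurableSet_Icc).2 hf
  rw [← intervalIntegral.integral_Iic_sub_Iic hg.integrableOn hg.integrableOn,
    integral_Iic_eq_integral_Iio' (by simp) (x := t), lebI,
    Measure.restrict_restrict measurableSet_Iio,
    setIntegral_indicator measurableSet_Icc (s := Iio t)]
  ring

theorem ae_hasDerivAt_setIntegral_Iio {f : ℝ → ℝ} (hf : Integrable f lebI) :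
    ∀ᵐ x ∂lebI, HasDerivAt (fun t => ∫ y in Iio t, f y ∂lebI) (f x) x := by
  have hg : Integrable ((Icc (0 : ℝ) 1).indicator f) volume :=
    (integrable_indicator_iff measurableSet_Icc).2 hf
  simp only [setIntegral_Iio_eq_intervalIntegral hf]
  have h1 := _root_.LocallyIntegrable.ae_hasDerivAt_integral hg.locallyIntegrable
  rw [lebI]
  filter_upwards [ae_restrict_of_ae h1, ae_restrict_mem measurableSet_Icc] with x hx hx1
  have := (hx 0).const_add (∫ x in Iic 0, (Icc (0 : ℝ) 1).indicator f x)
  rwa [indicator_of_mem hx1] at this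

theorem setIntegral_stepL1 {k : ℕ} {v : Fin k → ℝ} (hv : ∀ i, 0 ≤ v i) {A : Set ℝ}
    (hA : MeasurableSet A) : ∫ x in A, stepL1 k v x ∂lebI = (stepMeas k v).real A := by
  rw [← setIntegral_stepFn_eq hv hA]
  exact integral_congr_ae (ae_restrict_of_ae (memLp_stepFn k v).coeFn_toLp)

/-- Integration over `A` is a bounded functional on `L¹`. -/
theorem tendsto_setIntegral_of_weak {ι : Type*} {l : Filter ι} {u : ι → Lp ℝ 1 lebI}
    {f : Lp ℝ 1 lebI}
    (h : Tendsto (fun j => toWeakSpace ℝ (Lp ℝ 1 lebI) (u j)) l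
      (𝓝 (toWeakSpace ℝ (Lp ℝ 1 lebI) f))) (A : Set ℝ) :
    Tendsto (fun j => ∫ x in A, u j x ∂lebI) l (𝓝 (∫ x in A, f x ∂lebI)) := by
  have : Fact ((1 : ℝ≥0∞) ≤ 1) := ⟨le_rfl⟩
  set φ : StrongDual ℝ (Lp ℝ 1 lebI) :=
    (L1.integralCLM (E := ℝ) (μ := lebI.restrict A)).comp (LpToLpRestrictCLM ℝ ℝ ℝ lebI 1 A)
  have hφ : ∀ g : Lp ℝ 1 lebI, φ g = ∫ x in A, g x ∂lebI := fun g => by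
    rw [← integral_congr_ae (LpToLpRestrictCLM_coeFn ℝ A g), ← L1.integral_eq_integral,
      L1.integral_eq]
    rfl
  have h2 := ((WeakBilin.eval_continuous (topDualPairing ℝ (Lp ℝ 1 lebI)).flip φ).tendsto
    (toWeakSpace ℝ (Lp ℝ 1 lebI) f)).comp h
  simp only [← hφ]
  exact h2

theorem measurable_stepFn (k : ℕ) (v : Fin k → ℝ) : Measurable (stepFn k v) :=
  Finset.measurable_fun_sum _ fun i _ => measurable_const.indicator (measurableSet_cell i)

variable {ι : Type*} {l : Filter ι} {k : ι → ℕ} {v : (j : ι) → Fin (k j) → ℝ}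

/-- Decreasing step functions converge wherever the limit of their distribution functions is
differentiable. -/
theorem tendsto_stepFn_of_hasDerivAt (hk : ∀ᶠ j in l, 1 ≤ k j)
    (hv : ∀ᶠ j in l, ∀ i, 0 ≤ v j i) (ha : ∀ᶠ j in l, Antitone (v j)) {F : ℝ → ℝ}
    (hF : ∀ t, Tendsto (fun j => cum (stepMeas (k j) (v j)) t) l (𝓝 (F t))) {x d : ℝ}
    (hx : x ∈ Ioo (0 : ℝ) 1) (hd : HasDerivAt F d x) :
    Tendsto (fun j => stepFn (k j) (v j) x) l (𝓝 d) := by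
  rw [hasDerivAt_iff_tendsto_slope_left_right] at hd
  refine tendsto_order.2 ⟨fun d' hd' => ?_, fun d' hd' => ?_⟩
  -- The value at `x` dominates the mean over any interval to its right and is dominated by the mean
  -- over any interval to its left. These means converge to difference quotients of `F`, which are
  -- close to `d`.
  · obtain ⟨y, hy1, hy2⟩ := ((hd.2.eventually (lt_mem_nhds hd')).and (Ioo_mem_nhdsGT hx.2)).exists
    rw [slope_def_field] at hy1
    have h1 := (((hF y).sub (hF x)).div_const (y - x)).eventually (lt_mem_nhds hy1)
    filter_upwards [h1, hk, hv, ha] with j hj hkj hvj haj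
    refine hj.trans_le ?_
    rw [← measureReal_Ico_eq_cum _ hy2.1.le, div_le_iff₀ (sub_pos.2 hy2.1)]
    exact stepMeas_Ico_le hkj hvj haj hx.1.le hy2.1.le hy2.2.le
  · obtain ⟨y, hy1, hy2⟩ := ((hd.1.eventually (gt_mem_nhds hd')).and (Ioo_mem_nhdsLT hx.1)).exists
    rw [slope_comm, slope_def_field] at hy1
    have h1 := (((hF x).sub (hF y)).div_const (x - y)).eventually (gt_mem_nhds hy1)
    filter_upwards [h1, hk, hv, ha] with j hj hkj hvj haj
    refine lt_of_le_of_lt ?_ hj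
    rw [← measureReal_Ico_eq_cum _ hy2.2.le, le_div_iff₀ (sub_pos.2 hy2.2)]
    exact le_stepMeas_Ico hkj hvj haj hy2.1.le hy2.2.le hx.2.le

theorem tendsto_stepL1_of_ae [l.IsCountablyGenerated] (hv : ∀ᶠ j in l, ∀ i, 0 ≤ v j i) {C : ℝ}
    (hC : 0 ≤ C) (hb : ∀ᶠ j in l, ∀ i, v j i ≤ C) {g : Lp ℝ 1 lebI}
    (h : ∀ᵐ x ∂lebI, Tendsto (fun j => stepFn (k j) (v j) x) l (𝓝 (g x))) :
    Tendsto (fun j => stepL1 (k j) (v j)) l (𝓝 g) := by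
  rw [tendsto_iff_norm_sub_tendsto_zero]
  have e : ∀ j, ‖stepL1 (k j) (v j) - g‖ = ∫ x, |stepFn (k j) (v j) x - g x| ∂lebI := fun j => by
    rw [L1.norm_eq_integral_norm]
    refine integral_congr_ae ?_
    filter_upwards [Lp.coeFn_sub (stepL1 (k j) (v j)) g,
      (memLp_stepFn (k j) (v j)).coeFn_toLp] with x h1 h2
    rw [h1, Pi.sub_apply, stepL1, h2, Real.norm_eq_abs]
  simp only [e]
  have hg := integrable_Lp_lebI g
  have := tendsto_integral_filter_of_dominated_convergence (μ := lebI) (l := l)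
    (F := fun j x => |stepFn (k j) (v j) x - g x|) (f := fun _ => 0) (fun x => C + |g x|)
    (Eventually.of_forall fun j =>
      ((measurable_stepFn (k j) (v j)).aestronglyMeasurable.sub hg.1).norm)
    (by
      filter_upwards [hv, hb] with j hvj hbj
      refine Eventually.of_forall fun x => ?_
      rw [Real.norm_eq_abs, abs_abs]
      refine (abs_sub _ _).trans ?_
      rw [abs_of_nonneg (stepFn_nonneg hvj x)]
      exact add_le_add_left (stepFn_le hC hbj x) _)
    ((integrable_const C).add hg.abs)
    (by
      filter_upwards [h] with x hx
      have := (hx.sub_const (g x)).abs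
      rwa [sub_self, abs_zero] at this)
  simpa using this

theorem ae_tendsto_stepFn_of_tendsto_setIntegral (hk : ∀ᶠ j in l, 1 ≤ k j)
    (hv : ∀ᶠ j in l, ∀ i, 0 ≤ v j i) (ha : ∀ᶠ j in l, Antitone (v j)) {f : Lp ℝ 1 lebI}
    (h : ∀ t, Tendsto (fun j => ∫ x in Iio t, stepL1 (k j) (v j) x ∂lebI) l
      (𝓝 (∫ x in Iio t, f x ∂lebI))) :
    ∀ᵐ x ∂lebI, Tendsto (fun j => stepFn (k j) (v j) x) l (𝓝 (f x)) := by
  filter_upwards [ae_lebI_mem_Ioo, ae_hasDerivAt_setIntegral_Iio (integrable_Lp_lebI f)]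
    with x hx hd
  refine tendsto_stepFn_of_hasDerivAt hk hv ha (fun t => (h t).congr' ?_) hx hd
  filter_upwards [hv] with j hj
  exact setIntegral_stepL1 hj measurableSet_Iio

theorem stepMeas_real_le {k : ℕ} {v : Fin k → ℝ} (hk : 1 ≤ k) (hv : ∀ i, 0 ≤ v i) {C : ℝ}
    (hb : ∀ i, v i ≤ C) {A : Set ℝ} (hA : MeasurableSet A) :
    (stepMeas k v).real A ≤ C * lebI.real A := by
  rw [stepMeas_real hv hA, ← sum_lebI_inter_cell hk hA, Finset.mul_sum]
  exact Finset.sum_le_sum fun i _ => mul_le_mul_of_nonneg_right (hb i) measureReal_nonneg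

theorem lebI_real_Ico_le {s t : ℝ} (hst : s ≤ t) : lebI.real (Ico s t) ≤ t - s := by
  rw [lebI, measureReal_restrict_apply measurableSet_Ico]
  refine (measureReal_mono inter_subset_left (by simp)).trans ?_
  rw [Real.volume_real_Ico, max_eq_left (sub_nonneg.2 hst)]

theorem lebI_real_univ : lebI.real univ = 1 := by
  rw [lebI, measureReal_restrict_apply MeasurableSet.univ, univ_inter, Real.volume_real_Icc]
  norm_num

theorem cum_stepMeas_lipschitz {k : ℕ} {v : Fin k → ℝ} (hk : 1 ≤ k) (hv : ∀ i, 0 ≤ v i)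
    {C : ℝ} (hC : 0 ≤ C) (hb : ∀ i, v i ≤ C) (s t : ℝ) :
    |cum (stepMeas k v) s - cum (stepMeas k v) t| ≤ C * |s - t| := by
  wlog hst : s ≤ t generalizing s t
  · rw [abs_sub_comm, abs_sub_comm s]
    exact this t s (le_of_not_ge hst)
  rw [abs_sub_comm, abs_sub_comm s, abs_of_nonneg (sub_nonneg.2 hst), abs_of_nonneg
    (sub_nonneg.2 (cum_mono _ hst)), ← measureReal_Ico_eq_cum _ hst]
  exact (stepMeas_real_le hk hv hb measurableSet_Ico).trans
    (mul_le_mul_of_nonneg_left (lebI_real_Ico_le hst) hC)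

/-- Bounded sequences of decreasing step functions have subsequences that converge in `L¹`. -/
theorem exists_subseq_tendsto_stepL1 {k : ℕ → ℕ} {v : (j : ℕ) → Fin (k j) → ℝ}
    (hk : ∀ j, 1 ≤ k j) (hv : ∀ j i, 0 ≤ v j i) (ha : ∀ j, Antitone (v j)) {C : ℝ} (hC : 0 ≤ C)
    (hb : ∀ j i, v j i ≤ C) :
    ∃ (g : Lp ℝ 1 lebI) (φ : ℕ → ℕ), StrictMono φ ∧
      Tendsto (fun j => stepL1 (k (φ j)) (v (φ j))) atTop (𝓝 g) := by
  set G : ℕ → ℝ → ℝ := fun j t => cum (stepMeas (k j) (v j)) t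
  have hlip : ∀ j s t, |G j s - G j t| ≤ C * |s - t| := fun j =>
    cum_stepMeas_lipschitz (hk j) (hv j) hC (hb j)
  -- Compactness of a product extracts convergence at all rational points; the common Lipschitz
  -- constant spreads it to every real.
  have hK : IsCompact (Set.pi univ fun _ : ℚ => Icc (0 : ℝ) C) :=
    isCompact_univ_pi fun _ => isCompact_Icc
  obtain ⟨L, -, φ, hφ, hL⟩ := hK.tendsto_subseq (x := fun j (q : ℚ) => G j q) (by
    intro j q _
    refine ⟨measureReal_nonneg, ?_⟩
    refine (stepMeas_real_le (hk j) (hv j) (hb j) measurableSet_Iio).trans ?_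
    have : lebI.real (Iio (q : ℝ)) ≤ 1 :=
      (measureReal_mono (subset_univ _)).trans lebI_real_univ.le
    nlinarith)
  have hcauchy : ∀ t, CauchySeq fun j => G (φ j) t := by
    intro t
    refine Metric.cauchySeq_iff.2 fun ε hε => ?_
    obtain ⟨q, hq1, hq2⟩ := exists_rat_btwn (show t < t + ε / (3 * (C + 1)) by
      have : 0 < ε / (3 * (C + 1)) := by positivity
      linarith)
    have hqt : C * |t - q| < ε / 3 := by
      rw [abs_sub_comm, abs_of_pos (sub_pos.2 hq1)]
      have h1 : (q : ℝ) - t < ε / (3 * (C + 1)) := by linarith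
      rw [lt_div_iff₀ (by positivity)] at h1
      nlinarith
    have hLq : CauchySeq fun j => G (φ j) q := (tendsto_pi_nhds.1 hL q).cauchySeq
    obtain ⟨N, hN⟩ := Metric.cauchySeq_iff.1 hLq (ε / 3) (by positivity)
    refine ⟨N, fun m hm n hn => ?_⟩
    have h1 := hN m hm n hn
    have h2 := hlip (φ m) t q
    have h3 := hlip (φ n) t q
    rw [Real.dist_eq] at h1 ⊢
    rw [abs_lt] at h1 ⊢
    rw [abs_le] at h2 h3
    constructor <;> linarith [h1.1, h1.2, h2.1, h2.2, h3.1, h3.2]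
  choose F hF using fun t => cauchySeq_tendsto_of_complete (hcauchy t)
  have hFlip : LipschitzWith ⟨C, hC⟩ F := by
    refine LipschitzWith.of_dist_le_mul fun s t => ?_
    rw [Real.dist_eq, Real.dist_eq]
    exact le_of_tendsto ((hF s).sub (hF t)).abs (Eventually.of_forall fun j => hlip _ s t)
  -- The limit density. Where `F` is not differentiable, `deriv` takes the value 0; this is a null
  -- set as `F` is Lipschitz.
  have hmem : MemLp (deriv F) 1 lebI :=
    MemLp.of_bound (measurable_deriv F).aestronglyMeasurable C
      (Eventually.of_forall fun x => norm_deriv_le_of_lipschitz hFlip)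
  refine ⟨hmem.toLp _, φ, hφ, ?_⟩
  refine tendsto_stepL1_of_ae (Eventually.of_forall fun j => hv _) hC
    (Eventually.of_forall fun j => hb _) ?_
  have hdiff : ∀ᵐ x ∂lebI, DifferentiableAt ℝ F x :=
    ae_restrict_of_ae hFlip.ae_differentiableAt_real
  filter_upwards [ae_lebI_mem_Ioo, hdiff, hmem.coeFn_toLp] with x hx hd he
  rw [he]
  exact tendsto_stepFn_of_hasDerivAt (Eventually.of_forall fun j => hk _)
    (Eventually.of_forall fun j => hv _) (Eventually.of_forall fun j => ha _) hF hx hd.hasDerivAt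

/-- A sequence in the closure is shadowed by one in `S` at distances tending to 0. -/
theorem isCompact_closure_of_subseq {X : Type*} [MetricSpace X] {S : Set X}
    (h : ∀ u : ℕ → X, (∀ j, u j ∈ S) →
      ∃ (g : X) (φ : ℕ → ℕ), StrictMono φ ∧ Tendsto (fun j => u (φ j)) atTop (𝓝 g)) :
    IsCompact (closure S) := by
  refine IsSeqCompact.isCompact fun u hu => ?_
  have hex : ∀ j : ℕ, ∃ w ∈ S, dist (u j) w < 1 / ((j : ℝ) + 1) := fun j =>
    Metric.mem_closure_iff.1 (hu j) _ (by positivity)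
  choose w hw hd using hex
  obtain ⟨g, φ, hφ, hlim⟩ := h w hw
  refine ⟨g, mem_closure_of_tendsto hlim (Eventually.of_forall fun j => hw _), φ, hφ, ?_⟩
  refine (tendsto_iff_of_dist ?_).2 hlim
  have h0 := (tendsto_one_div_add_atTop_nhds_zero_nat (𝕜 := ℝ)).comp hφ.tendsto_atTop
  exact squeeze_zero (fun _ => dist_nonneg) (fun j => (hd _).le) h0

theorem isCompact_closure_weak {E : Type*} [NormedAddCommGroup E] [NormedSpace ℝ E] {S : Set E}
    (h : IsCompact (closure S)) : IsCompact (closure (toWeakSpace ℝ E '' S)) := by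
  have h1 : IsCompact (toWeakSpace ℝ E '' closure S) := h.image (toWeakSpaceCLM ℝ E).continuous
  exact h1.of_isClosed_subset isClosed_closure
    (closure_minimal (image_mono subset_closure) h1.isClosed)

end Convergence

/-! ### Limits of Ulam densities are invariant -/

section Invariance

theorem ext_of_cum {μ ν : Measure ℝ} [IsFiniteMeasure μ] [IsFiniteMeasure ν]
    (h : ∀ t, cum μ t = cum ν t) : μ = ν := by
  refine Measure.ext_of_Ico μ ν fun s t hst => ?_
  have : μ.real (Ico s t) = ν.real (Ico s t) := by
    rw [measureReal_Ico_eq_cum μ hst.le, measureReal_Ico_eq_cum ν hst.le, h, h]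
  exact (measureReal_eq_measureReal_iff).1 this

/-- The measure `f dλ`. -/
noncomputable def densMeas (f : ℝ → ℝ) : Measure ℝ :=
  lebI.withDensity fun x => ENNReal.ofReal (f x)

theorem densMeas_ac (f : ℝ → ℝ) : densMeas f ≪ lebI := withDensity_absolutelyContinuous _ _

theorem isFiniteMeasure_densMeas {f : ℝ → ℝ} (hf : Integrable f lebI) :
    IsFiniteMeasure (densMeas f) := isFiniteMeasure_withDensity_ofReal hf.2

theorem densMeas_real {f : ℝ → ℝ} (hf : Integrable f lebI) (h0 : 0 ≤ᵐ[lebI] f) {A : Set ℝ}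
    (hA : MeasurableSet A) : (densMeas f).real A = ∫ x in A, f x ∂lebI := by
  rw [integral_eq_lintegral_of_nonneg_ae (ae_restrict_of_ae h0) hf.1.restrict, Measure.real,
    densMeas, withDensity_apply _ hA]

theorem cum_of_nonpos {μ : Measure ℝ} (hμ : μ ≪ lebI) {t : ℝ} (ht : t ≤ 0) : cum μ t = 0 := by
  have : μ (Iio t) = 0 := by
    refine hμ (measure_eq_zero_iff_ae_notMem.2 ?_)
    filter_upwards [ae_lebI_mem_Ioo] with x hx h
    exact lt_irrefl _ (hx.1.trans ((mem_Iio.1 h).trans_le ht))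
  simp [cum, Measure.real, this]

theorem cum_of_one_le {μ : Measure ℝ} (hμ : μ ≪ lebI) {t : ℝ} (ht : 1 ≤ t) :
    cum μ t = μ.real univ := by
  refine measureReal_congr ?_
  filter_upwards [hμ.ae_le ae_lebI_mem_Ioo] with x hx
  exact propext ⟨fun _ => trivial, fun _ => hx.2.trans_le ht⟩

variable {T : ℝ → ℝ} {b c : ℕ → ℝ}

theorem cum_map_of_nonpos (hm : Measurable T) (hT : ∀ x, T x ∈ Ico (0 : ℝ) 1) (μ : Measure ℝ)
    {t : ℝ} (ht : t ≤ 0) : cum (μ.map T) t = 0 := by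
  rw [cum, map_measureReal_apply hm measurableSet_Iio, preimage_eq_empty, measureReal_empty]
  refine Set.disjoint_left.2 ?_
  rintro _ h1 ⟨x, rfl⟩
  exact absurd ((hT x).1.trans_lt (mem_Iio.1 h1)) (not_lt.2 ht)

theorem cum_map_of_one_le (hm : Measurable T) (hT : ∀ x, T x ∈ Ico (0 : ℝ) 1) (μ : Measure ℝ)
    {t : ℝ} (ht : 1 ≤ t) : cum (μ.map T) t = μ.real univ := by
  rw [cum, map_measureReal_apply hm measurableSet_Iio, preimage_eq_univ_iff.2]
  rintro _ ⟨x, rfl⟩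
  exact (hT x).2.trans_le ht

/-- On each branch `T` expands by at least `c m`, so its inverse is Lipschitz and maps null sets to
null sets (via one-dimensional Hausdorff measure). -/
theorem IsConvexBranched.nonsingular (h : IsConvexBranched T b c) : lebI.map T ≪ lebI := by
  refine Measure.AbsolutelyContinuous.mk fun N hN h0 => ?_
  rw [Measure.map_apply h.meas hN]
  have key : ∀ m, volume (T ⁻¹' N ∩ Ico (b (m + 1)) (b m)) = 0 := by
    intro m
    set S := T ⁻¹' N ∩ Ico (b (m + 1)) (b m)
    have hSb : S ⊆ Ico (b (m + 1)) (b m) := inter_subset_right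
    have hinj : InjOn T S := (h.strictMonoOn m).injOn.mono hSb
    have hleft : LeftInvOn (Function.invFunOn T S) T S := hinj.leftInvOn_invFunOn
    have hexp : ∀ x ∈ S, ∀ y ∈ S, c m * |x - y| ≤ |T x - T y| := by
      intro x hx y hy
      rcases le_total x y with hxy | hxy
      · rw [abs_sub_comm, abs_sub_comm (T x), abs_of_nonneg (sub_nonneg.2 hxy)]
        exact (h.slope m x (hSb hx) y (hSb hy) hxy).trans (le_abs_self _)
      · rw [abs_of_nonneg (sub_nonneg.2 hxy)]
        exact (h.slope m y (hSb hy) x (hSb hx) hxy).trans (le_abs_self _)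
    have hlip : LipschitzOnWith ⟨(c m)⁻¹, (inv_pos.2 (h.c_pos m)).le⟩
        (Function.invFunOn T S) (T '' S) := by
      refine LipschitzOnWith.of_dist_le_mul ?_
      rintro _ ⟨x, hx, rfl⟩ _ ⟨y, hy, rfl⟩
      rw [hleft hx, hleft hy, Real.dist_eq, Real.dist_eq]
      change _ ≤ (c m)⁻¹ * _
      rw [inv_mul_eq_div, le_div_iff₀ (h.c_pos m), mul_comm]
      exact hexp x hx y hy
    have h1 := hlip.hausdorffMeasure_image_le (d := 1) zero_le_one
    rw [hleft.image_image, hausdorffMeasure_real] at h1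
    have h2 : volume (T '' S) = 0 := by
      refine measure_mono_null ?_ (show volume (N ∩ Icc (0 : ℝ) 1) = 0 by
        rwa [lebI, Measure.restrict_apply hN] at h0)
      rintro _ ⟨x, hx, rfl⟩
      exact ⟨hx.1, Ico_subset_Icc_self (h.maps x)⟩
    rw [h2, mul_zero] at h1
    exact le_antisymm h1 zero_le
  have h2 : lebI (⋃ m, T ⁻¹' N ∩ Ico (b (m + 1)) (b m)) = 0 :=
    measure_iUnion_null fun m => Measure.absolutelyContinuous_of_le Measure.restrict_le_self (key m)
  refine measure_mono_null_ae ?_ h2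
  filter_upwards [h.ae_mem_iUnion_branch] with x hx hxN
  rw [← inter_iUnion]
  exact ⟨hxN, hx⟩

/-- For the Borel version `T` of `τ`, the fixed points of the Frobenius-Perron operator of `τ` are
the densities of the `T`-invariant signed measures. -/
theorem frobeniusPerron_fixed_iff {τ : ℝ → ℝ} (he : τ =ᵐ[lebI] T) (hm : Measurable T)
    (hns : lebI.map T ≪ lebI) (f : Lp ℝ 1 lebI) :
    frobeniusPerron τ f =ᵐ[lebI] f ↔ ∀ A, MeasurableSet A →
      ∫ x in T ⁻¹' A, f x ∂lebI = ∫ x in A, f x ∂lebI := by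
  have hτ : AEMeasurable τ lebI := ⟨T, hm, he⟩
  have hns' : lebI.map τ ≪ lebI := by rwa [Measure.map_congr he]
  have hf := integrable_Lp_lebI f
  obtain ⟨h1, h2⟩ := frobeniusPerron_spec hτ hns' hf
  have h3 : ∀ A : Set ℝ, ∫ x in τ ⁻¹' A, f x ∂lebI = ∫ x in T ⁻¹' A, f x ∂lebI := fun A => by
    refine setIntegral_congr_set ?_
    filter_upwards [he] with x hx
    exact propext (show τ x ∈ A ↔ T x ∈ A by rw [hx])
  constructor
  · intro h A hA
    rw [← h3, ← h2 A hA]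
    exact integral_congr_ae (ae_restrict_of_ae h)
  · intro h
    refine h1.ae_eq_of_forall_setIntegral_eq _ _ hf fun A hA _ => ?_
    rw [h2 A hA, h3, h A hA]

theorem setIntegral_preimage_eq_iff_map {f : ℝ → ℝ} (hf : Integrable f lebI)
    (h0 : 0 ≤ᵐ[lebI] f) (hm : Measurable T) :
    (∀ A, MeasurableSet A → ∫ x in T ⁻¹' A, f x ∂lebI = ∫ x in A, f x ∂lebI) ↔
      (densMeas f).map T = densMeas f := by
  have := isFiniteMeasure_densMeas hf
  constructor
  · intro h
    ext A hA
    refine (measureReal_eq_measureReal_iff).1 ?_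
    rw [map_measureReal_apply hm hA, densMeas_real hf h0 hA, densMeas_real hf h0 (hm hA), h A hA]
  · intro h A hA
    rw [← densMeas_real hf h0 hA, ← densMeas_real hf h0 (hm hA), ← map_measureReal_apply hm hA, h]

/-- The fixed point equation says that a step measure and its image give the same mass to every
cell. -/
theorem IsConvexBranched.cum_map_grid (h : IsConvexBranched T b c) {k : ℕ} (hk : 1 ≤ k)
    {v : Fin k → ℝ} (hv : IsUlamDensity T k v) {p : ℕ} (hp : p ≤ k) :
    cum ((stepMeas k v).map T) ((p : ℝ) / k) = cum (stepMeas k v) ((p : ℝ) / k) := by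
  have hk0 : (0 : ℝ) < k := by exact_mod_cast hk
  induction p with
  | zero =>
    simp only [Nat.cast_zero, zero_div]
    rw [cum_map_of_nonpos h.meas h.maps _ le_rfl, cum_of_nonpos (stepMeas_ac v) le_rfl]
  | succ p ih =>
    set j : Fin k := ⟨p, hp⟩
    have hlt := (cell_lt hk j).le
    have e1 := measureReal_Ico_eq_cum ((stepMeas k v).map T) hlt
    have e2 := measureReal_Ico_eq_cum (stepMeas k v) hlt
    have e3 : ((stepMeas k v).map T).real (cell k j) = (stepMeas k v).real (cell k j) := by
      rw [map_measureReal_apply h.meas (measurableSet_cell j)]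
      have h1 := ulamOp_apply h.meas hv.1 j
      rw [hv.2.1] at h1
      have h2 : (stepMeas k v).real (cell k j) = v j / k := by
        rw [stepMeas_real hv.1 (measurableSet_cell j), Finset.sum_eq_single j, inter_self,
          lebI_real_cell, mul_one_div]
        · intro i _ hij
          rw [(disjoint_cells hij.symm).inter_eq, measureReal_empty, mul_zero]
        · simp
      rw [h2, h1]
      field_simp
    change ((stepMeas k v).map T).real (Ico _ _) = (stepMeas k v).real (Ico _ _) at e3
    rw [e1, e2] at e3
    have e4 := ih (by omega)
    push_cast
    change _ - cum _ ((p : ℝ) / k) = _ - cum _ ((p : ℝ) / k) at e3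
    change cum _ (((p : ℝ) + 1) / k) - _ = cum _ (((p : ℝ) + 1) / k) - _ at e3
    linarith

/-- Both distribution functions are monotone and agree at the two neighbouring grid points, between
which they grow by at most `C / k`. -/
theorem IsConvexBranched.abs_cum_map_sub_le (h : IsConvexBranched T b c) {k : ℕ} (hk : 1 ≤ k)
    {v : Fin k → ℝ} (hv : IsUlamDensity T k v) {C : ℝ} (hC : 0 ≤ C) (hb : ∀ i, v i ≤ C) (y : ℝ) :
    |cum ((stepMeas k v).map T) y - cum (stepMeas k v) y| ≤ C / k := by
  have hk0 : (0 : ℝ) < k := by exact_mod_cast hk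
  have hCk : 0 ≤ C / k := by positivity
  rcases le_or_gt y 0 with hy0 | hy0
  · rwa [cum_map_of_nonpos h.meas h.maps _ hy0, cum_of_nonpos (stepMeas_ac v) hy0, sub_zero,
      abs_zero]
  rcases le_or_gt 1 y with hy1 | hy1
  · rwa [cum_map_of_one_le h.meas h.maps _ hy1, cum_of_one_le (stepMeas_ac v) hy1, sub_self,
      abs_zero]
  have hyk : 0 ≤ y * k := by positivity
  set p := ⌊y * k⌋₊
  have hp : p < k := by
    rw [Nat.floor_lt hyk]
    nlinarith
  have h1 : (p : ℝ) / k ≤ y := by rw [div_le_iff₀ hk0]; exact Nat.floor_le hyk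
  have h2 : y ≤ ((p + 1 : ℕ) : ℝ) / k := by
    rw [le_div_iff₀ hk0]; push_cast; exact (Nat.lt_floor_add_one _).le
  have e1 := h.cum_map_grid hk hv hp.le
  have e2 := h.cum_map_grid hk hv (show p + 1 ≤ k from hp)
  have m1 := cum_mono ((stepMeas k v).map T) h1
  have m2 := cum_mono ((stepMeas k v).map T) h2
  have m3 := cum_mono (stepMeas k v) h1
  have m4 := cum_mono (stepMeas k v) h2
  have hl := cum_stepMeas_lipschitz hk hv.1 hC hb (((p + 1 : ℕ) : ℝ) / k) ((p : ℝ) / k)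
  have e3 : C * |((p + 1 : ℕ) : ℝ) / k - (p : ℝ) / k| = C / k := by
    rw [← sub_div, Nat.cast_add, Nat.cast_one, add_sub_cancel_left, abs_of_pos (by positivity),
      mul_one_div]
  rw [e3] at hl
  have hl' := (abs_le.1 hl).2
  rw [abs_le]
  constructor <;> linarith

namespace IsPiecewiseConvexZero

variable {τ : ℝ → ℝ} {a : ℕ → ℝ}

/-- The two maps differ only on `[0, a n)`, whose mass is at most `C * a n`. -/
theorem abs_cum_map_approx_sub_le (hτ : IsPiecewiseConvexZero τ a) {n k : ℕ} (hn : 1 ≤ n)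
    (hk : 1 ≤ k) {v : Fin k → ℝ} (hv : ∀ i, 0 ≤ v i) {C : ℝ}
    (hb : ∀ i, v i ≤ C) (y : ℝ) :
    |cum ((stepMeas k v).map ((Ioo (0 : ℝ) 1).indicator (approxMap τ a n))) y
      - cum ((stepMeas k v).map ((Ioo (0 : ℝ) 1).indicator τ)) y| ≤ C * a n := by
  have h1 := (hτ.approx_isConvexBranched hn).meas
  have h2 := hτ.isConvexBranched.meas
  rw [cum, cum, map_measureReal_apply h1 measurableSet_Iio,
    map_measureReal_apply h2 measurableSet_Iio]
  set μ := stepMeas k v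
  have hD : μ.real (Ico 0 (a n)) ≤ C * a n := by
    refine (stepMeas_real_le hk hv hb measurableSet_Ico).trans ?_
    rw [lebI_real_Ico le_rfl (hτ.a_pos n).le (hτ.a_le_one n), sub_zero]
  have hagree : ∀ x, x ∉ Ico 0 (a n) → (Ioo (0 : ℝ) 1).indicator (approxMap τ a n) x
      = (Ioo (0 : ℝ) 1).indicator τ x := by
    intro x hx
    by_cases hx1 : x ∈ Ioo (0 : ℝ) 1
    · rw [indicator_of_mem hx1, indicator_of_mem hx1]
      exact if_neg fun h => hx ⟨hx1.1.le, h⟩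
    · rw [indicator_of_notMem hx1, indicator_of_notMem hx1]
  have key : ∀ A B : Set ℝ, A ⊆ B ∪ Ico 0 (a n) → μ.real A ≤ μ.real B + C * a n :=
    fun A B hAB => (measureReal_mono hAB).trans ((measureReal_union_le _ _).trans (by linarith))
  rw [abs_sub_le_iff]
  constructor
  · rw [sub_le_iff_le_add']
    refine key _ _ fun x hx => ?_
    by_cases hxD : x ∈ Ico 0 (a n)
    · exact Or.inr hxD
    · left
      rwa [mem_preimage, hagree x hxD] at hx
  · rw [sub_le_iff_le_add']
    refine key _ _ fun x hx => ?_
    by_cases hxD : x ∈ Ico 0 (a n)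
    · exact Or.inr hxD
    · left
      rwa [mem_preimage, ← hagree x hxD] at hx

/-- Limits of the fixed points of the Ulam operators are invariant densities of `τ`. -/
theorem frobeniusPerron_fixed_of_tendsto (hτ : IsPiecewiseConvexZero τ a) {n k : ℕ → ℕ}
    (hn1 : ∀ j, 1 ≤ n j) (hk1 : ∀ j, 1 ≤ k j) {v : (j : ℕ) → Fin (k j) → ℝ}
    (hv : ∀ j, IsUlamDensity (approxMap τ a (n j)) (k j) (v j)) (hn : Tendsto n atTop atTop)
    (hk : Tendsto k atTop atTop) {f : Lp ℝ 1 lebI} (hf0 : 0 ≤ᵐ[lebI] f)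
    (hlim : ∀ A : Set ℝ, MeasurableSet A → Tendsto (fun j => (stepMeas (k j) (v j)).real A) atTop
      (𝓝 (∫ x in A, f x ∂lebI))) :
    frobeniusPerron τ f =ᵐ[lebI] f := by
  have h := hτ.isConvexBranched
  obtain ⟨C, hC, hb⟩ := hτ.exists_bound
  have hf := integrable_Lp_lebI f
  have := isFiniteMeasure_densMeas hf
  rw [frobeniusPerron_fixed_iff (indicator_ae_eq τ) h.meas h.nonsingular,
    setIntegral_preimage_eq_iff_map hf hf0 h.meas]
  refine ext_of_cum fun y => ?_
  rw [cum, cum, map_measureReal_apply h.meas measurableSet_Iio,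
    densMeas_real hf hf0 (h.meas measurableSet_Iio), densMeas_real hf hf0 measurableSet_Iio]
  -- The preimage of a half-line is not a half-line, which is why convergence on all Borel sets is
  -- assumed.
  have l1 := hlim _ (h.meas (measurableSet_Iio (a := y)))
  have l2 := hlim _ (measurableSet_Iio (a := y))
  have l3 : Tendsto (fun j => C * a (n j) + C / (k j : ℝ)) atTop (𝓝 0) := by
    have h1 := (hτ.a_lim.comp hn).const_mul C
    have h2 := (tendsto_const_div_atTop_nhds_zero_nat C).comp hk
    have h3 := h1.add h2
    simpa using h3
  refine sub_eq_zero.1 (tendsto_nhds_unique (l1.sub l2)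
    (squeeze_zero_norm (fun j => ?_) l3))
  rw [Real.norm_eq_abs, ← map_measureReal_apply h.meas measurableSet_Iio]
  have hvj := (isUlamDensity_congr (indicator_ae_eq (approxMap τ a (n j))) _).1 (hv j)
  have hbj := hb (n j) (k j) (hn1 j) (hk1 j) (v j) (hv j)
  have e1 := (hτ.approx_isConvexBranched (hn1 j)).abs_cum_map_sub_le (hk1 j) hvj hC hbj y
  have e2 := hτ.abs_cum_map_approx_sub_le (hn1 j) (hk1 j) hvj.1 hbj y
  rw [abs_sub_comm] at e2
  exact (abs_sub_le _ _ _).trans (add_le_add e2 e1)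

end IsPiecewiseConvexZero

end Invariance

/-! ### Itineraries, and monotonicity of invariant densities -/

/-- The points to the right of `x` that visit the same branches as `x` during the first `n`
steps. -/
def follow (T : ℝ → ℝ) (b : ℕ → ℝ) : ℕ → ℝ → Set ℝ
  | 0, x => Ici x
  | n + 1, x => Ici x ∩ (⋃ m, ⋃ (_ : x ∈ Ico (b (m + 1)) (b m)), Ico (b (m + 1)) (b m)) ∩
      T ⁻¹' follow T b n (T x)

section Follow

variable {T : ℝ → ℝ} {b c : ℕ → ℝ}

theorem measurableSet_follow (hm : Measurable T) (n : ℕ) (x : ℝ) :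
    MeasurableSet (follow T b n x) := by
  induction n generalizing x with
  | zero => exact measurableSet_Ici
  | succ n ih =>
    exact (measurableSet_Ici.inter (MeasurableSet.iUnion fun m => MeasurableSet.iUnion fun _ =>
      measurableSet_Ico)).inter (hm (ih (T x)))

theorem follow_antitone (T : ℝ → ℝ) (b : ℕ → ℝ) (x : ℝ) :
    Antitone fun n => follow T b n x := by
  refine antitone_nat_of_succ_le fun n => ?_
  induction n generalizing x with
  | zero => exact fun z hz => hz.1.1
  | succ n ih => exact fun z hz => ⟨hz.1, ih (T x) hz.2⟩

theorem mem_follow_succ {n : ℕ} {x z : ℝ} : z ∈ follow T b (n + 1) x ↔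
    x ≤ z ∧ (∃ m, x ∈ Ico (b (m + 1)) (b m) ∧ z ∈ Ico (b (m + 1)) (b m)) ∧
      T z ∈ follow T b n (T x) := by
  simp only [follow, mem_inter_iff, mem_Ici, mem_iUnion, exists_prop, mem_preimage, and_assoc]

/-- The relative length of an interval grows at each step that stays inside one branch. -/
theorem IsConvexBranched.relative_length_le (h : IsConvexBranched T b c) {m : ℕ} {u w : ℝ}
    (hl : 0 < b (m + 1)) (hu : u ∈ Ico (b (m + 1)) (b m)) (hw : w ∈ Ico (b (m + 1)) (b m))
    (huw : u < w) (hTu : 0 < T u) :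
    (1 + b (m + 1)) * ((w - u) / u) ≤ (T w - T u) / T u := by
  set l := b (m + 1)
  have hbm := h.pos_of_mem_branch hu
  have hz := h.zero m hbm
  have hlu : l < u := lt_of_le_of_ne hu.1 fun he => by
    have := hTu
    rw [← he, hz] at this
    exact lt_irrefl _ this
  have hu1 : u ≤ 1 := hu.2.le.trans (h.b_le_one m)
  have hsec := (h.conv m).secant_mono ⟨le_rfl, h.strict m hbm⟩ hu hw hlu.ne' (hlu.trans huw).ne'
    huw.le
  rw [hz, sub_zero, sub_zero, div_le_div_iff₀ (sub_pos.2 hlu) (sub_pos.2 (hlu.trans huw))] at hsec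
  have h1 : (w - u) / (u - l) ≤ (T w - T u) / T u := by
    rw [div_le_div_iff₀ (sub_pos.2 hlu) hTu]
    nlinarith
  refine le_trans ?_ h1
  rw [← mul_div_assoc, div_le_div_iff₀ (hl.trans hlu) (sub_pos.2 hlu)]
  -- The chord from `(l, 0)` yields the factor `u / (u - l)`; it is at least `1 + l` because `u ≤
  -- 1`.
  have h2 : (1 + l) * (u - l) ≤ u := by nlinarith
  nlinarith [mul_le_mul_of_nonneg_left h2 (sub_pos.2 huw).le]

/-- There are no wandering intervals. -/
theorem IsConvexBranched.not_forall_mem_follow (h : IsConvexBranched T b c) (hb : ∀ m, 0 < b m)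
    (hc : Tendsto c atTop atTop) {x y : ℝ} (hxy : x < y) : ¬ ∀ n, y ∈ follow T b n x := by
  intro hall
  have hinv : ∀ j : ℕ, T^[j] x < T^[j] y ∧ ∀ n, T^[j] y ∈ follow T b n (T^[j] x) := by
    intro j
    induction j with
    | zero => exact ⟨hxy, hall⟩
    | succ j ih =>
      rw [Function.iterate_succ_apply', Function.iterate_succ_apply']
      obtain ⟨_, ⟨m, hx, hy⟩, _⟩ := mem_follow_succ.1 (ih.2 1)
      exact ⟨h.strictMonoOn m hx hy ih.1, fun n => (mem_follow_succ.1 (ih.2 (n + 1))).2.2⟩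
  have hbr : ∀ j : ℕ, ∃ m, T^[j] x ∈ Ico (b (m + 1)) (b m) ∧ T^[j] y ∈ Ico (b (m + 1)) (b m) :=
    fun j => (mem_follow_succ.1 ((hinv j).2 1)).2.1
  choose m hmx hmy using hbr
  have hpos : ∀ j, 0 < T^[j] x := fun j => (hb _).trans_le (hmx j).1
  have hle1 : ∀ j, T^[j] y ≤ 1 := fun j => (hmy j).2.le.trans (h.b_le_one _)
  -- From index `N` on the branches at least double lengths. If branches before `N` recur, the
  -- relative length never decreases and gains the factor `1 + b N` at each visit, but is then at
  -- most `1 / b N`. Otherwise lengths eventually double at each step inside `[0, 1]`.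
  obtain ⟨N, hN⟩ := (hc.eventually_ge_atTop 2).exists_forall_of_atTop
  by_cases hfreq : ∃ᶠ j in atTop, m j < N
  · set e : ℕ → ℝ := fun j => (T^[j] y - T^[j] x) / T^[j] x with he
    have he0 : ∀ j, 0 < e j := fun j => div_pos (sub_pos.2 (hinv j).1) (hpos j)
    have hstep : ∀ j, (1 + b (m j + 1)) * e j ≤ e (j + 1) := fun j => by
      have := h.relative_length_le (hb _) (hmx j) (hmy j) (hinv j).1
        (by rw [← Function.iterate_succ_apply' T]; exact hpos (j + 1))
      simp only [he, Function.iterate_succ_apply']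
      exact this
    have hmono : Monotone e := monotone_nat_of_le_succ fun j => by
      nlinarith [hstep j, he0 j, hb (m j + 1)]
    have hgrow : ∀ K : ℕ, ∃ j₀, ∀ j ≥ j₀, (1 + b N) ^ K * e 0 ≤ e j := by
      intro K
      induction K with
      | zero => exact ⟨0, fun j hj => by simpa using hmono hj⟩
      | succ K ih =>
        obtain ⟨j₀, hj₀⟩ := ih
        obtain ⟨j, hj, hmj⟩ := (frequently_atTop.1 hfreq) j₀
        refine ⟨j + 1, fun i hi => ?_⟩
        have h1 : b N ≤ b (m j + 1) := h.anti hmj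
        calc (1 + b N) ^ (K + 1) * e 0 = (1 + b N) * ((1 + b N) ^ K * e 0) := by ring
          _ ≤ (1 + b N) * e j := mul_le_mul_of_nonneg_left (hj₀ j hj) (by linarith [hb N])
          _ ≤ (1 + b (m j + 1)) * e j :=
            mul_le_mul_of_nonneg_right (by linarith) (he0 j).le
          _ ≤ e (j + 1) := hstep j
          _ ≤ e i := hmono hi
    obtain ⟨K, hK⟩ := pow_unbounded_of_one_lt (1 / b N / e 0)
      (show 1 < 1 + b N by linarith [hb N])
    obtain ⟨j₀, hj₀⟩ := hgrow K
    obtain ⟨j, hj, hmj⟩ := (frequently_atTop.1 hfreq) j₀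
    have h1 := hj₀ j hj
    rw [div_lt_iff₀ (he0 0)] at hK
    have h2 : b N ≤ T^[j] x := (h.anti hmj).trans (hmx j).1
    have h3 : e j ≤ 1 / b N := by
      refine div_le_div₀ zero_le_one ?_ (hb N) h2
      linarith [hle1 j, hpos j]
    linarith
  · rw [not_frequently] at hfreq
    obtain ⟨J, hJ⟩ := hfreq.exists_forall_of_atTop
    have hgrow : ∀ i : ℕ, 2 ^ i * (T^[J] y - T^[J] x) ≤ T^[J + i] y - T^[J + i] x := by
      intro i
      induction i with
      | zero => simp
      | succ i ih =>
        have h1 := hN (m (J + i)) (not_lt.1 (hJ (J + i) (by omega)))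
        have h2 := h.slope _ _ (hmx (J + i)) _ (hmy (J + i)) (hinv (J + i)).1.le
        rw [← add_assoc, Function.iterate_succ_apply', Function.iterate_succ_apply', pow_succ]
        nlinarith [(hinv (J + i)).1]
    have hd : 0 < T^[J] y - T^[J] x := sub_pos.2 (hinv J).1
    obtain ⟨i, hi⟩ := pow_unbounded_of_one_lt (1 / (T^[J] y - T^[J] x)) (one_lt_two (α := ℝ))
    rw [div_lt_iff₀ hd] at hi
    linarith [hgrow i, hle1 (J + i), hpos (J + i)]

/-- The sets decrease, and their intersection contains at most `x`, as there are no wandering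
intervals. -/
theorem IsConvexBranched.tendsto_lebI_follow (h : IsConvexBranched T b c) (hb : ∀ m, 0 < b m)
    (hc : Tendsto c atTop atTop) (x : ℝ) :
    Tendsto (fun n => lebI.real (follow T b n x)) atTop (𝓝 0) := by
  have h1 := tendsto_measure_iInter_atTop (μ := lebI)
    (fun n => (measurableSet_follow (b := b) h.meas n x).nullMeasurableSet)
    (follow_antitone T b x) ⟨0, measure_ne_top _ _⟩
  have h2 : lebI (⋂ n, follow T b n x) = 0 := by
    refine measure_mono_null (t := {x}) (fun y hy => ?_) ?_
    · have hy' := mem_iInter.1 hy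
      by_contra hne
      have hxy : x ≤ y := hy' 0
      exact h.not_forall_mem_follow hb hc (lt_of_le_of_ne hxy (Ne.symm hne)) hy'
    · exact Measure.absolutelyContinuous_of_le Measure.restrict_le_self (by simp)
  rw [h2] at h1
  exact (ENNReal.tendsto_toReal ENNReal.zero_ne_top).comp h1

theorem IsConvexBranched.map_ac (h : IsConvexBranched T b c) {μ : Measure ℝ} (hμ : μ ≪ lebI) :
    μ.map T ≪ lebI := (hμ.map h.meas).trans h.nonsingular

theorem IsConvexBranched.cum_map_iterate_concave (h : IsConvexBranched T b c) (n : ℕ)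
    {μ : Measure ℝ} [IsFiniteMeasure μ] (hμ : μ ≪ lebI) (hG : ConcaveOn ℝ (Icc 0 1) (cum μ)) :
    ConcaveOn ℝ (Icc 0 1) (cum (μ.map T^[n])) := by
  induction n generalizing μ with
  | zero => simpa using hG
  | succ n ih =>
    rw [Function.iterate_succ, ← Measure.map_map (h.meas.iterate n) h.meas]
    exact ih (h.map_ac hμ) (h.cum_map_concave_of_concave hμ hG)

/-- The image under `T^[n]` of a measure whose density vanishes to the left of `x` and decreases
to the right of `x` has a decreasing density, up to the mass of the points that follow `x`. -/
theorem IsConvexBranched.exists_concave_approx (h : IsConvexBranched T b c) (n : ℕ) {x : ℝ}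
    (hx : x ∈ Ico (0 : ℝ) 1) {μ : Measure ℝ} [IsFiniteMeasure μ] (hμ : μ ≪ lebI)
    (hG : ConcaveOn ℝ (Icc x 1) (cum μ)) (h0 : μ (Iio x) = 0) :
    ∃ G : ℝ → ℝ, ConcaveOn ℝ (Icc 0 1) G ∧
      ∀ t, |cum (μ.map T^[n]) t - G t| ≤ μ.real (follow T b n x) := by
  induction n generalizing x μ with
  | zero =>
    -- Before any step all the mass follows `x`, so the zero function is good enough.
    refine ⟨fun _ => 0, concaveOn_const 0 (convex_Icc 0 1), fun t => ?_⟩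
    have e : μ.real (follow T b 0 x) = μ.real univ := by
      refine measureReal_congr ?_
      filter_upwards [measure_eq_zero_iff_ae_notMem.1 h0] with y hy
      exact propext ⟨fun _ => trivial, fun _ => not_lt.1 hy⟩
    rw [Function.iterate_zero, Measure.map_id, sub_zero, e,
      abs_of_nonneg (show 0 ≤ cum μ t from measureReal_nonneg)]
    exact measureReal_mono (subset_univ _)
  | succ n ih =>
    rcases hx.1.eq_or_lt with rfl | hx0
    · refine ⟨_, h.cum_map_iterate_concave (n + 1) hμ hG, fun t => ?_⟩
      rw [sub_self, abs_zero]
      exact measureReal_nonneg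
    · obtain ⟨m, hm⟩ := h.exists_branch ⟨hx0, hx.2⟩
      -- Cut at the end of the branch of `x`. After one step the right part has a decreasing
      -- density, because it fills whole branches; the image of the left part has the original shape
      -- with `T x` in place of `x`, so induction applies.
      set μ₁ := μ.restrict (Ici (b m)) with hμ₁
      set μ₂ := μ.restrict (Ico x (b m)) with hμ₂
      have hac₁ : μ₁ ≪ lebI := (Measure.absolutelyContinuous_of_le Measure.restrict_le_self).trans hμ
      have hac₂ : μ₂ ≪ lebI := (Measure.absolutelyContinuous_of_le Measure.restrict_le_self).trans hμ
      have hsum : μ = μ₁ + μ₂ := by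
        have e : μ₂ = μ.restrict (Ici (b m))ᶜ := by
          refine Measure.restrict_congr_set ?_
          filter_upwards [measure_eq_zero_iff_ae_notMem.1 h0] with y hy
          exact propext ⟨fun hy' => not_le.2 hy'.2, fun hy' => ⟨not_lt.1 hy, not_le.1 hy'⟩⟩
        rw [e]
        exact (Measure.restrict_add_restrict_compl measurableSet_Ici).symm
      -- The density of `μ₁` may jump up at `b m`, so concavity holds only branch by branch; this is
      -- all that `cum_map_concave` requires.
      have hc₁ : ∀ m', ConcaveOn ℝ (Icc (b (m' + 1)) (b m')) (cum μ₁) := by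
        intro m'
        rcases le_or_gt m m' with hmm | hmm
        · refine (concaveOn_const 0 (convex_Icc _ _)).congr fun t ht => ?_
          have : Iio t ∩ Ici (b m) = ∅ := by
            ext z
            simp only [mem_inter_iff, mem_Iio, mem_Ici, mem_empty_iff_false, iff_false, not_and,
              not_le]
            exact fun hz => hz.trans_le (ht.2.trans (h.anti hmm))
          rw [cum, measureReal_restrict_apply measurableSet_Iio, this, measureReal_empty]
        · have hbm : b m ≤ b (m' + 1) := h.anti hmm
          have hsub : Icc (b (m' + 1)) (b m') ⊆ Icc x 1 := fun z hz =>
            ⟨hm.2.le.trans (hbm.trans hz.1), hz.2.trans (h.b_le_one _)⟩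
          refine ((hG.subset hsub (convex_Icc _ _)).add_const (-cum μ (b m))).congr
            fun t ht => ?_
          have : Iio t ∩ Ici (b m) = Ico (b m) t := by
            ext z; simp [and_comm]
          change cum μ t - cum μ (b m) = μ₁.real (Iio t)
          rw [measureReal_restrict_apply measurableSet_Iio, this,
            measureReal_Ico_eq_cum μ (hbm.trans ht.1)]
      have hpre : ∀ t, T ⁻¹' Iio t ∩ Ico x (b m) = Ico x (branchInv T b m t) := by
        intro t
        have h1 := h.preimage_inter_branch m t
        have h2 := (h.branchInv_mem m t).2
        ext z
        constructor
        · rintro ⟨hz1, hz2⟩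
          have : z ∈ Ico (b (m + 1)) (branchInv T b m t) := by
            rw [← h1]; exact ⟨hz1, hm.1.trans hz2.1, hz2.2⟩
          exact ⟨hz2.1, this.2⟩
        · rintro ⟨hz1, hz2⟩
          have : z ∈ T ⁻¹' Iio t ∩ Ico (b (m + 1)) (b m) := by
            rw [h1]; exact ⟨hm.1.trans hz1, hz2⟩
          exact ⟨this.1, hz1, this.2.2⟩
      have hc₂ : ConcaveOn ℝ (Icc (T x) 1) (cum (μ₂.map T)) := by
        have hsx : ∀ t ∈ Icc (T x) 1, x ≤ branchInv T b m t := fun t ht =>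
          h.le_branchInv hm ht.1
        have h1 := h.comp_branchInv_concave m
          (hG.subset (Icc_subset_Icc_right (h.b_le_one m)) (convex_Icc _ _)) (cum_mono μ)
          (convex_Icc (T x) 1) (fun t ht => (h.maps x).1.trans ht.1) hsx
        refine (h1.add_const (-cum μ x)).congr fun t ht => ?_
        change cum μ (branchInv T b m t) - cum μ x = (μ₂.map T).real (Iio t)
        rw [map_measureReal_apply h.meas measurableSet_Iio,
          measureReal_restrict_apply (h.meas measurableSet_Iio), hpre,
          measureReal_Ico_eq_cum μ (hsx t ht)]
      have h0₂ : (μ₂.map T) (Iio (T x)) = 0 := by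
        rw [Measure.map_apply h.meas measurableSet_Iio,
          Measure.restrict_apply (h.meas measurableSet_Iio)]
        have : T ⁻¹' Iio (T x) ∩ Ico x (b m) = ∅ := by
          ext z
          simp only [mem_inter_iff, mem_preimage, mem_Iio, mem_empty_iff_false, iff_false, not_and]
          exact fun hz hz2 => absurd hz (not_lt.2 ((h.strictMonoOn m).monotoneOn hm
            ⟨hm.1.trans hz2.1, hz2.2⟩ hz2.1))
        rw [this, measure_empty]
      have hG₁ := h.cum_map_iterate_concave n (h.map_ac hac₁) (h.cum_map_concave hac₁ hc₁)
      obtain ⟨G₂, hG₂, hG₂'⟩ := ih (h.maps x) (h.map_ac hac₂) hc₂ h0₂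
      refine ⟨_, hG₁.add hG₂, fun t => ?_⟩
      have hmeas := measurableSet_follow (b := b) h.meas n (T x)
      have e : cum (μ.map T^[n + 1]) t
          = cum ((μ₁.map T).map T^[n]) t + cum ((μ₂.map T).map T^[n]) t := by
        rw [Function.iterate_succ, ← Measure.map_map (h.meas.iterate n) h.meas]
        conv_lhs => rw [hsum, Measure.map_add _ _ h.meas, Measure.map_add _ _ (h.meas.iterate n)]
        exact measureReal_add_apply
      rw [e, Pi.add_apply, add_sub_add_left_eq_sub]
      refine (hG₂' t).trans ?_
      rw [map_measureReal_apply h.meas hmeas, measureReal_restrict_apply (h.meas hmeas)]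
      refine measureReal_mono fun z hz => mem_follow_succ.2 ⟨hz.2.1, ⟨m, hm, ?_⟩, hz.1⟩
      exact ⟨hm.1.trans hz.2.1, hz.2.2⟩

theorem cum_lebI_restrict_concave {x y : ℝ} (hx : 0 ≤ x) (hxy : x ≤ y) (hy : y ≤ 1) :
    ConcaveOn ℝ (Icc x 1) (cum (lebI.restrict (Ico x y))) := by
  have h1 : ConcaveOn ℝ (Icc x 1) (fun t : ℝ => t) := concaveOn_id (convex_Icc _ _)
  have h2 : ConcaveOn ℝ (Icc x 1) (fun _ : ℝ => y) := concaveOn_const _ (convex_Icc _ _)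
  refine ((h1.inf h2).add_const (-x)).congr fun t ht => ?_
  have : Iio t ∩ Ico x y = Ico x (min t y) := by
    ext z; simp only [mem_inter_iff, mem_Iio, mem_Ico, lt_min_iff]; tauto
  rw [cum, measureReal_restrict_apply measurableSet_Iio, this,
    lebI_real_Ico hx (le_min ht.1 hxy) ((min_le_right _ _).trans hy)]
  rfl

/-- Each cell carries a constant density starting at its left end point. Its error is the measure of
the points following that end point, which tends to 0, and there are finitely many cells. -/
theorem IsConvexBranched.exists_concave_approx_stepMeas (h : IsConvexBranched T b c)
    (hb : ∀ m, 0 < b m) (hc : Tendsto c atTop atTop) {k : ℕ} (hk : 1 ≤ k) {v : Fin k → ℝ}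
    (hv : ∀ i, 0 ≤ v i) {ε : ℝ} (hε : 0 < ε) :
    ∃ (n : ℕ) (G : ℝ → ℝ), ConcaveOn ℝ (Icc 0 1) G ∧
      ∀ t, |cum ((stepMeas k v).map T^[n]) t - G t| ≤ ε := by
  have hlim : Tendsto (fun n => ∑ i : Fin k, v i * lebI.real (follow T b n ((i : ℝ) / k))) atTop
      (𝓝 (∑ i : Fin k, v i * 0)) :=
    tendsto_finsetSum _ fun i _ => (h.tendsto_lebI_follow hb hc _).const_mul _
  simp only [mul_zero, Finset.sum_const_zero] at hlim
  obtain ⟨n, hn⟩ := (hlim.eventually (gt_mem_nhds hε)).exists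
  have hex : ∀ i : Fin k, ∃ G : ℝ → ℝ, ConcaveOn ℝ (Icc 0 1) G ∧
      ∀ t, |cum ((lebI.restrict (cell k i)).map T^[n]) t - G t|
        ≤ lebI.real (follow T b n ((i : ℝ) / k)) := by
    intro i
    obtain ⟨G, hG, hG'⟩ := h.exists_concave_approx n (μ := lebI.restrict (cell k i))
      (x := (i : ℝ) / k) ⟨cell_left_nonneg i, (cell_lt hk i).trans_le (cell_right_le i)⟩
      (Measure.absolutelyContinuous_of_le Measure.restrict_le_self)
      (cum_lebI_restrict_concave (cell_left_nonneg i) (cell_lt hk i).le (cell_right_le i))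
      (by
        rw [Measure.restrict_apply measurableSet_Iio, cell]
        have : Iio ((i : ℝ) / k) ∩ Ico ((i : ℝ) / k) (((i : ℝ) + 1) / k) = ∅ := by
          ext z
          simp only [mem_inter_iff, mem_Iio, mem_Ico, mem_empty_iff_false, iff_false]
          rintro ⟨h1, h2, _⟩
          exact absurd h1 (not_lt.2 h2)
        rw [this, measure_empty])
    refine ⟨G, hG, fun t => (hG' t).trans ?_⟩
    rw [measureReal_restrict_apply (measurableSet_follow h.meas n _)]
    exact measureReal_mono inter_subset_left
  choose G hG hG' using hex
  refine ⟨n, fun t => ∑ i, v i * G i t, ?_, fun t => ?_⟩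
  · refine ⟨convex_Icc 0 1, fun s hs t ht p q hp hq hpq => ?_⟩
    simp only [smul_eq_mul, Finset.mul_sum, ← Finset.sum_add_distrib]
    refine Finset.sum_le_sum fun i _ => ?_
    have := mul_le_mul_of_nonneg_left ((hG i).2 hs ht hp hq hpq) (hv i)
    simp only [smul_eq_mul] at this
    linarith
  · have e : cum ((stepMeas k v).map T^[n]) t
        = ∑ i, v i * cum ((lebI.restrict (cell k i)).map T^[n]) t := by
      have hm := h.meas.iterate n
      rw [cum, map_measureReal_apply hm measurableSet_Iio, stepMeas_real hv (hm measurableSet_Iio)]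
      refine Finset.sum_congr rfl fun i _ => ?_
      rw [cum, map_measureReal_apply hm measurableSet_Iio,
        measureReal_restrict_apply (hm measurableSet_Iio)]
    rw [e, ← Finset.sum_sub_distrib]
    refine (Finset.abs_sum_le_sum_abs _ _).trans (le_trans (Finset.sum_le_sum fun i _ => ?_) hn.le)
    rw [← mul_sub, abs_mul, abs_of_nonneg (hv i)]
    exact mul_le_mul_of_nonneg_left (hG' i t) (hv i)

/-- Approximate by a continuous function, sample it at left end points of cells and truncate at 0;
truncation does not hurt as `f` is nonnegative. -/
theorem exists_stepFn_approx {f : ℝ → ℝ} (hf : Integrable f lebI) (h0 : 0 ≤ᵐ[lebI] f) {ε : ℝ}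
    (hε : 0 < ε) : ∃ (k : ℕ) (v : Fin k → ℝ), 1 ≤ k ∧ (∀ i, 0 ≤ v i) ∧
      ∫ x, |f x - stepFn k v x| ∂lebI ≤ ε := by
  have : (lebI).WeaklyRegular := by unfold lebI; infer_instance
  obtain ⟨g, hg, hgi⟩ := hf.exists_boundedContinuous_integral_sub_le (half_pos hε)
  have huc := isCompact_Icc.uniformContinuousOn_of_continuous
    (s := Icc (0 : ℝ) 1) g.continuous.continuousOn
  obtain ⟨δ, hδ, hgδ⟩ := Metric.uniformContinuousOn_iff.1 huc (ε / 2) (half_pos hε)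
  obtain ⟨n, hn⟩ := exists_nat_one_div_lt hδ
  refine ⟨n + 1, fun i => max (g ((i : ℝ) / (n + 1 : ℕ))) 0, by omega,
    fun i => le_max_right _ _, ?_⟩
  set v : Fin (n + 1) → ℝ := fun i => max (g ((i : ℝ) / (n + 1 : ℕ))) 0
  have hsi : Integrable (stepFn (n + 1) v) lebI := (memLp_stepFn (n + 1) v).integrable le_rfl
  have hbound : ∀ᵐ x ∂lebI, |f x - stepFn (n + 1) v x| ≤ ‖f x - g x‖ + ε / 2 := by
    filter_upwards [ae_lebI_mem_Ioo, h0] with x hx hfx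
    obtain ⟨i, hi⟩ := exists_cell (k := n + 1) (by omega) ⟨hx.1.le, hx.2⟩
    rw [stepFn_of_mem v hi, Real.norm_eq_abs]
    have hd : dist (g x) (g ((i : ℝ) / (n + 1 : ℕ))) < ε / 2 := by
      refine hgδ x ⟨hx.1.le, hx.2.le⟩ _
        ⟨cell_left_nonneg i, (cell_lt (by omega) i).le.trans (cell_right_le i)⟩ ?_
      rw [Real.dist_eq, abs_of_nonneg (sub_nonneg.2 hi.1)]
      have h2 := hi.2
      rw [add_div] at h2
      push_cast at h2 ⊢
      linarith
    have e1 : |f x - max (g x) 0| ≤ |f x - g x| := by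
      have hfx' : max (f x) 0 = f x := max_eq_left hfx
      calc |f x - max (g x) 0| = |max (f x) 0 - max (g x) 0| := by rw [hfx']
        _ ≤ |f x - g x| := abs_max_sub_max_le_abs _ _ _
    have e2 : |max (g x) 0 - v i| ≤ ε / 2 :=
      (abs_max_sub_max_le_abs _ _ _).trans hd.le
    exact (abs_sub_le _ _ _).trans (add_le_add e1 e2)
  have hi1 : Integrable (fun x => ‖f x - g x‖) lebI := (hf.sub hgi).norm
  have e : ∫ x, (‖f x - g x‖ + ε / 2) ∂lebI = (∫ x, ‖f x - g x‖ ∂lebI) + ε / 2 := by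
    rw [integral_add hi1 (integrable_const _), integral_const, lebI_real_univ, one_smul]
  calc ∫ x, |f x - stepFn (n + 1) v x| ∂lebI ≤ ∫ x, (‖f x - g x‖ + ε / 2) ∂lebI :=
        integral_mono_ae (hf.sub hsi).abs (hi1.add (integrable_const (ε / 2))) hbound
    _ ≤ ε := by rw [e]; linarith

theorem map_iterate_eq {μ : Measure ℝ} (hm : Measurable T) (hinv : μ.map T = μ) (n : ℕ) :
    μ.map T^[n] = μ := by
  induction n with
  | zero => simp
  | succ n ih => rw [Function.iterate_succ, ← Measure.map_map (hm.iterate n) hm, hinv, ih]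

/-- Every invariant density is decreasing. -/
theorem IsConvexBranched.cum_concave_of_invariant (h : IsConvexBranched T b c)
    (hb : ∀ m, 0 < b m) (hc : Tendsto c atTop atTop) {f : ℝ → ℝ} (hf : Integrable f lebI)
    (h0 : 0 ≤ᵐ[lebI] f) (hinv : (densMeas f).map T = densMeas f) :
    ConcaveOn ℝ (Icc 0 1) (cum (densMeas f)) := by
  -- Invariance allows replacing the measure by its image under any `T^[n]`, and an `L¹` error
  -- bounds the error of integrals over all preimages. Uniform limits of concave functions are
  -- concave.
  have key : ∀ ε > 0, ∃ G : ℝ → ℝ, ConcaveOn ℝ (Icc 0 1) G ∧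
      ∀ t, |cum (densMeas f) t - G t| ≤ ε := by
    intro ε hε
    obtain ⟨k, v, hk, hv, hfv⟩ := exists_stepFn_approx hf h0 (half_pos hε)
    obtain ⟨n, G, hG, hG'⟩ := h.exists_concave_approx_stepMeas hb hc hk hv (half_pos hε)
    refine ⟨G, hG, fun t => ?_⟩
    have hm := h.meas.iterate n
    have hsi : Integrable (stepFn k v) lebI := (memLp_stepFn k v).integrable le_rfl
    have h1 : |cum (densMeas f) t - cum ((stepMeas k v).map T^[n]) t| ≤ ε / 2 := by
      rw [← map_iterate_eq h.meas hinv n, cum, cum, map_measureReal_apply hm measurableSet_Iio,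
        map_measureReal_apply hm measurableSet_Iio, densMeas_real hf h0 (hm measurableSet_Iio),
        ← setIntegral_stepFn_eq hv (hm measurableSet_Iio),
        ← integral_sub hf.integrableOn hsi.integrableOn]
      refine (abs_integral_le_integral_abs).trans (le_trans ?_ hfv)
      exact setIntegral_le_integral (hf.sub hsi).abs (Eventually.of_forall fun x => abs_nonneg _)
    have := (abs_sub_le _ _ _).trans (add_le_add h1 (hG' t))
    linarith
  refine ⟨convex_Icc 0 1, fun s hs t ht p q hp hq hpq => ?_⟩
  refine le_of_forall_pos_le_add fun ε hε => ?_
  obtain ⟨G, hG, hG'⟩ := key (ε / 2) (half_pos hε)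
  have h1 := hG.2 hs ht hp hq hpq
  have h2 := (abs_le.1 (hG' s)).2
  have h3 := (abs_le.1 (hG' t)).2
  have h4 := (abs_le.1 (hG' (p • s + q • t))).1
  simp only [smul_eq_mul] at h1 h4 ⊢
  have h5 := mul_le_mul_of_nonneg_left h2 hp
  have h6 := mul_le_mul_of_nonneg_left h3 hq
  have h7 : p * (ε / 2) + q * (ε / 2) = ε / 2 := by rw [← add_mul, hpq, one_mul]
  linarith

end Follow

/-! ### Uniqueness of the invariant density -/

section InvariantDensity

theorem continuous_setIntegral_Iio {f : ℝ → ℝ} (hf : Integrable f lebI) :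
    Continuous fun t => ∫ x in Iio t, f x ∂lebI := by
  have hg : Integrable ((Icc (0 : ℝ) 1).indicator f) volume :=
    (integrable_indicator_iff measurableSet_Icc).2 hf
  simp only [setIntegral_Iio_eq_intervalIntegral hf]
  exact continuous_const.add
    (intervalIntegral.continuous_primitive (fun _ _ => hg.intervalIntegrable) 0)

theorem cum_densMeas {f : ℝ → ℝ} (hf : Integrable f lebI) (h0 : 0 ≤ᵐ[lebI] f) :
    cum (densMeas f) = fun t => ∫ x in Iio t, f x ∂lebI :=
  funext fun _ => densMeas_real hf h0 measurableSet_Iio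

theorem densMeas_real_univ {f : ℝ → ℝ} (hf : Integrable f lebI) (h0 : 0 ≤ᵐ[lebI] f) :
    (densMeas f).real univ = ∫ x, f x ∂lebI := by
  rw [densMeas_real hf h0 MeasurableSet.univ, setIntegral_univ]

/-- A decreasing density can vanish only where its distribution function is maximal. -/
theorem ae_integral_le_cum_of_eq_zero {f : ℝ → ℝ} (hf : Integrable f lebI) (h0 : 0 ≤ᵐ[lebI] f)
    (hc : ConcaveOn ℝ (Icc 0 1) (cum (densMeas f))) :
    ∀ᵐ x ∂lebI, f x = 0 → ∫ y, f y ∂lebI ≤ cum (densMeas f) x := by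
  filter_upwards [ae_lebI_mem_Ioo, ae_hasDerivAt_setIntegral_Iio hf] with x hx hd hfx
  rw [← cum_densMeas hf h0, hfx] at hd
  have := hc.slope_le_of_hasDerivAt ⟨hx.1.le, hx.2.le⟩ ⟨zero_le_one, le_rfl⟩ hx.2 hd
  rw [slope_def_field, div_le_iff₀ (sub_pos.2 hx.2), zero_mul,
    cum_of_one_le (densMeas_ac f) le_rfl, densMeas_real_univ hf h0] at this
  linarith

/-- Almost everywhere one of the functions vanishes, and there its distribution function has reached
the common mass. So the sum of the two distribution functions is at least this mass, but it is
continuous and vanishes at 0. -/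
theorem integral_eq_zero_of_disjoint_of_concave {f g : ℝ → ℝ} (hf : Integrable f lebI)
    (hg : Integrable g lebI) (hf0 : 0 ≤ᵐ[lebI] f) (hg0 : 0 ≤ᵐ[lebI] g)
    (hfc : ConcaveOn ℝ (Icc 0 1) (cum (densMeas f)))
    (hgc : ConcaveOn ℝ (Icc 0 1) (cum (densMeas g))) (hdisj : ∀ x, f x = 0 ∨ g x = 0)
    (heq : ∫ x, f x ∂lebI = ∫ x, g x ∂lebI) : ∫ x, f x ∂lebI = 0 := by
  by_contra hne
  set M := ∫ x, f x ∂lebI with hM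
  have hMpos : 0 < M := lt_of_le_of_ne (integral_nonneg_of_ae hf0) (Ne.symm hne)
  have hcont : Continuous fun x => cum (densMeas f) x + cum (densMeas g) x := by
    rw [cum_densMeas hf hf0, cum_densMeas hg hg0]
    exact (continuous_setIntegral_Iio hf).add (continuous_setIntegral_Iio hg)
  have hae : ∀ᵐ x ∂lebI, M ≤ cum (densMeas f) x + cum (densMeas g) x := by
    filter_upwards [ae_integral_le_cum_of_eq_zero hf hf0 hfc,
      ae_integral_le_cum_of_eq_zero hg hg0 hgc] with x h1 h2
    have n1 : 0 ≤ cum (densMeas f) x := measureReal_nonneg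
    have n2 : 0 ≤ cum (densMeas g) x := measureReal_nonneg
    rcases hdisj x with h | h
    · linarith [h1 h]
    · linarith [h2 h]
  have hlt : ∀ᶠ x in 𝓝 (0 : ℝ), cum (densMeas f) x + cum (densMeas g) x < M := by
    refine (hcont.tendsto 0).eventually (gt_mem_nhds ?_)
    rwa [cum_of_nonpos (densMeas_ac f) le_rfl, cum_of_nonpos (densMeas_ac g) le_rfl, add_zero]
  obtain ⟨δ, hδ, hball⟩ := Metric.eventually_nhds_iff.1 hlt
  have hmin : 0 < min δ 1 := lt_min hδ one_pos
  have hnull : lebI (Ico 0 (min δ 1)) = 0 := by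
    refine measure_eq_zero_iff_ae_notMem.2 ?_
    filter_upwards [hae] with x hx hxm
    refine absurd (hball (y := x) ?_) (not_lt.2 hx)
    rw [Real.dist_eq, sub_zero, abs_of_nonneg hxm.1]
    exact hxm.2.trans_le (min_le_left _ _)
  have hpos := lebI_real_Ico le_rfl hmin.le (min_le_right δ 1)
  rw [Measure.real, hnull, ENNReal.toReal_zero, sub_zero] at hpos
  linarith

variable {T : ℝ → ℝ} {b c : ℕ → ℝ}

/-- The positive part of an invariant density is invariant. -/
theorem setIntegral_posPart_invariant {f : ℝ → ℝ} (hf : Integrable f lebI) (hfm : Measurable f)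
    (hm : Measurable T)
    (hinv : ∀ A, MeasurableSet A → ∫ x in T ⁻¹' A, f x ∂lebI = ∫ x in A, f x ∂lebI) (A : Set ℝ)
    (hA : MeasurableSet A) :
    ∫ x in T ⁻¹' A, max (f x) 0 ∂lebI = ∫ x in A, max (f x) 0 ∂lebI := by
  set P : Set ℝ := {x | 0 < f x}
  have hP : MeasurableSet P := measurableSet_lt measurable_const hfm
  have e1 : (fun x => max (f x) 0) = P.indicator f := by
    funext x
    by_cases hx : 0 < f x
    · rw [indicator_of_mem (show x ∈ P from hx), max_eq_left hx.le]
    · rw [indicator_of_notMem (show x ∉ P from hx), max_eq_right (not_lt.1 hx)]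
  -- The left side dominates the right side pointwise, and invariance tested on `P` gives them the
  -- same integral.
  have e2 : (fun x => max (f x) 0) =ᵐ[lebI] (T ⁻¹' P).indicator f := by
    have hi1 : Integrable (fun x => max (f x) 0) lebI := hf.pos_part
    have hi2 : Integrable ((T ⁻¹' P).indicator f) lebI := hf.indicator (hm hP)
    have hnn : 0 ≤ fun x => max (f x) 0 - (T ⁻¹' P).indicator f x := by
      intro x
      by_cases hx : x ∈ T ⁻¹' P
      · simp only [indicator_of_mem hx]
        exact sub_nonneg.2 (le_max_left _ _)
      · simp only [indicator_of_notMem hx, sub_zero]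
        exact le_max_right _ _
    have hzero : ∫ x, (max (f x) 0 - (T ⁻¹' P).indicator f x) ∂lebI = 0 := by
      rw [integral_sub hi1 hi2, e1, integral_indicator hP, integral_indicator (hm hP), hinv P hP,
        sub_self]
    filter_upwards [(integral_eq_zero_iff_of_nonneg hnn (hi1.sub hi2)).1 hzero] with x hx
    exact sub_eq_zero.1 hx
  rw [integral_congr_ae (ae_restrict_of_ae e2), e1, setIntegral_indicator hP,
    setIntegral_indicator (hm hP), ← preimage_inter, hinv _ (hA.inter hP)]

/-- The positive and negative parts are invariant, hence decreasing, of equal mass and nowhere both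
positive. -/
theorem IsConvexBranched.invariant_unique (h : IsConvexBranched T b c) (hb : ∀ m, 0 < b m)
    (hc : Tendsto c atTop atTop) {f : Lp ℝ 1 lebI}
    (hinv : ∀ A, MeasurableSet A → ∫ x in T ⁻¹' A, f x ∂lebI = ∫ x in A, f x ∂lebI)
    (hzero : ∫ x, f x ∂lebI = 0) : f = 0 := by
  have hf := integrable_Lp_lebI f
  have hfm : Measurable f := (Lp.stronglyMeasurable f).measurable
  have hinv' : ∀ A, MeasurableSet A →
      ∫ x in T ⁻¹' A, -f x ∂lebI = ∫ x in A, -f x ∂lebI := fun A hA => by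
    rw [integral_neg, integral_neg, hinv A hA]
  have n1 : 0 ≤ᵐ[lebI] fun x => max (f x) 0 := Eventually.of_forall fun x => le_max_right _ _
  have n2 : 0 ≤ᵐ[lebI] fun x => max (-f x) 0 := Eventually.of_forall fun x => le_max_right _ _
  have i1 : Integrable (fun x => max (f x) 0) lebI := hf.pos_part
  have i2 : Integrable (fun x => max (-f x) 0) lebI := hf.neg_part
  have c1 := h.cum_concave_of_invariant hb hc i1 n1 ((setIntegral_preimage_eq_iff_map i1 n1 h.meas).1
    (setIntegral_posPart_invariant hf hfm h.meas hinv))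
  have c2 := h.cum_concave_of_invariant hb hc i2 n2 ((setIntegral_preimage_eq_iff_map i2 n2 h.meas).1
    (setIntegral_posPart_invariant hf.neg hfm.neg h.meas hinv'))
  have hsplit : ∀ x, f x = max (f x) 0 - max (-f x) 0 := fun x => by
    rcases le_total (f x) 0 with h | h
    · rw [max_eq_right h, max_eq_left (by linarith)]; ring
    · rw [max_eq_left h, max_eq_right (by linarith)]; ring
  have heq : ∫ x, max (f x) 0 ∂lebI = ∫ x, max (-f x) 0 ∂lebI := by
    have e : ∫ x, f x ∂lebI = ∫ x, (max (f x) 0 - max (-f x) 0) ∂lebI :=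
      integral_congr_ae (Eventually.of_forall hsplit)
    rw [hzero, integral_sub i1 i2] at e
    linarith
  have z1 := integral_eq_zero_of_disjoint_of_concave i1 i2 n1 n2 c1 c2 (fun x => by
    rcases le_total (f x) 0 with h | h
    · exact Or.inl (max_eq_right h)
    · exact Or.inr (max_eq_right (by linarith))) heq
  have z2 := heq ▸ z1
  rw [Lp.eq_zero_iff_ae_eq_zero]
  filter_upwards [(integral_eq_zero_iff_of_nonneg_ae n1 i1).1 z1,
    (integral_eq_zero_iff_of_nonneg_ae n2 i2).1 z2] with x h1 h2
  simp only [Pi.zero_apply] at h1 h2 ⊢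
  rw [hsplit x, h1, h2, sub_zero]

theorem IsInvariantDensity.integral_eq_one {τ : ℝ → ℝ} {f : Lp ℝ 1 lebI}
    (hf : IsInvariantDensity τ f) : ∫ x, f x ∂lebI = 1 := by
  rw [← hf.2.1, L1.norm_eq_integral_norm]
  refine integral_congr_ae ?_
  filter_upwards [hf.1] with x hx
  exact (Real.norm_of_nonneg hx).symm

namespace IsPiecewiseConvexZero

variable {τ : ℝ → ℝ} {a : ℕ → ℝ}

/-- Summability enters the exclusion of wandering intervals only through this limit. -/
theorem tendsto_branchSlope (hτ : IsPiecewiseConvexZero τ a) :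
    Tendsto (branchSlope τ a) atTop atTop := by
  have h0 : Tendsto (fun m => 1 / branchSlope τ a m) atTop (𝓝 0) :=
    hτ.summable_inv_deriv.tendsto_atTop_zero
  have h1 : Tendsto (fun m => 1 / branchSlope τ a m) atTop (𝓝[>] 0) :=
    tendsto_nhdsWithin_iff.2 ⟨h0, Eventually.of_forall fun m =>
      one_div_pos.2 (hτ.branchSlope_pos m)⟩
  have h2 := tendsto_inv_nhdsGT_zero.comp h1
  refine h2.congr fun m => ?_
  simp

theorem invariantDensity_unique (hτ : IsPiecewiseConvexZero τ a) {f g : Lp ℝ 1 lebI}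
    (hf : IsInvariantDensity τ f) (hg : IsInvariantDensity τ g) : f = g := by
  have h := hτ.isConvexBranched
  have hfi := (frobeniusPerron_fixed_iff (indicator_ae_eq τ) h.meas h.nonsingular f).1 hf.2.2
  have hgi := (frobeniusPerron_fixed_iff (indicator_ae_eq τ) h.meas h.nonsingular g).1 hg.2.2
  have hsub : ∀ A : Set ℝ, ∫ x in A, (f - g : Lp ℝ 1 lebI) x ∂lebI
      = ∫ x in A, f x ∂lebI - ∫ x in A, g x ∂lebI := fun A => by
    rw [integral_congr_ae (ae_restrict_of_ae (Lp.coeFn_sub f g))]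
    exact integral_sub (integrable_Lp_lebI f).integrableOn (integrable_Lp_lebI g).integrableOn
  refine sub_eq_zero.1 (h.invariant_unique hτ.a_pos hτ.tendsto_branchSlope (fun A hA => ?_) ?_)
  · rw [hsub, hsub, hfi A hA, hgi A hA]
  · rw [← setIntegral_univ, hsub, setIntegral_univ, setIntegral_univ, hf.integral_eq_one,
      hg.integral_eq_one, sub_self]

theorem isInvariantDensity_of_tendsto (hτ : IsPiecewiseConvexZero τ a) {n k : ℕ → ℕ}
    (hn1 : ∀ j, 1 ≤ n j) (hk1 : ∀ j, 1 ≤ k j) {v : (j : ℕ) → Fin (k j) → ℝ}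
    (hv : ∀ j, IsUlamDensity (approxMap τ a (n j)) (k j) (v j)) (hn : Tendsto n atTop atTop)
    (hk : Tendsto k atTop atTop) {f : Lp ℝ 1 lebI}
    (hlim : Tendsto (fun j => stepL1 (k j) (v j)) atTop (𝓝 f)) : IsInvariantDensity τ f := by
  have hsetInt : ∀ A : Set ℝ, Tendsto (fun j => ∫ x in A, stepL1 (k j) (v j) x ∂lebI) atTop
      (𝓝 (∫ x in A, f x ∂lebI)) := fun A => ((continuous_setIntegral A).tendsto f).comp hlim
  have hae := ae_tendsto_stepFn_of_tendsto_setIntegral (Eventually.of_forall hk1)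
    (Eventually.of_forall fun j => (hv j).1)
    (Eventually.of_forall fun j => hτ.ulamDensity_antitone (hn1 j) (hk1 j) (hv j))
    (fun t => hsetInt (Iio t))
  have h0 : 0 ≤ᵐ[lebI] f := by
    filter_upwards [hae] with x hx
    exact ge_of_tendsto' hx fun j => stepFn_nonneg (hv j).1 x
  refine ⟨h0, ?_, ?_⟩
  · refine tendsto_nhds_unique hlim.norm ?_
    simp only [(hv _).2.2, tendsto_const_nhds]
  · refine hτ.frobeniusPerron_fixed_of_tendsto hn1 hk1 hv hn hk h0 fun A hA => ?_
    refine (hsetInt A).congr fun j => setIntegral_stepL1 (hv j).1 hA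

end IsPiecewiseConvexZero

end InvariantDensity

/-! ### The theorem -/

theorem theorem3p5 (τ : ℝ → ℝ) (a : ℕ → ℝ) (hτ : IsPiecewiseConvexZero τ a) :
    -- the normalized fixed point of each Ulam operator exists and is unique
    (∀ n k : ℕ, 1 ≤ n → 1 ≤ k → ∃! v : Fin k → ℝ, IsUlamDensity (approxMap τ a n) k v) ∧
    ∀ v : (n k : ℕ) → Fin k → ℝ,
      (∀ n k : ℕ, 1 ≤ n → 1 ≤ k → IsUlamDensity (approxMap τ a n) k (v n k)) →
      -- uniform boundedness in `L^∞`
      (∃ C : ℝ, ∀ n k : ℕ, 1 ≤ n → 1 ≤ k →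
        eLpNorm (stepFn k (v n k)) ∞ lebI ≤ ENNReal.ofReal C) ∧
      -- relative weak compactness in `L¹`
      IsCompact (closure {g : WeakSpace ℝ (Lp ℝ 1 lebI) | ∃ n k : ℕ, 1 ≤ n ∧ 1 ≤ k ∧
        g = toWeakSpace ℝ (Lp ℝ 1 lebI) (stepL1 k (v n k))}) ∧
      -- weakly convergent sequences from the family
      (∀ (n k : ℕ → ℕ) (f : Lp ℝ 1 lebI), (∀ j, 1 ≤ n j) → (∀ j, 1 ≤ k j) →
        Tendsto (fun j => toWeakSpace ℝ (Lp ℝ 1 lebI) (stepL1 (k j) (v (n j) (k j)))) atTop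
          (𝓝 (toWeakSpace ℝ (Lp ℝ 1 lebI) f)) →
        Tendsto (fun j => stepL1 (k j) (v (n j) (k j))) atTop (𝓝 f) ∧
        (∀ᵐ x ∂lebI, Tendsto (fun j => stepFn (k j) (v (n j) (k j)) x) atTop (𝓝 (f x))) ∧
        (Tendsto n atTop atTop → Tendsto k atTop atTop →
          frobeniusPerron τ f =ᵐ[lebI] f)) ∧
      -- convergence of the whole family to the unique invariant density of `τ`
      ∃ fstar : Lp ℝ 1 lebI, IsInvariantDensity τ fstar ∧
        (∀ g : Lp ℝ 1 lebI, IsInvariantDensity τ g → g = fstar) ∧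
        Tendsto (fun p : ℕ × ℕ => stepL1 p.2 (v p.1 p.2)) (atTop ×ˢ atTop) (𝓝 fstar) ∧
        ∀ᵐ x ∂lebI, Tendsto (fun p : ℕ × ℕ => stepFn p.2 (v p.1 p.2) x) (atTop ×ˢ atTop)
          (𝓝 (fstar x)) := by
  refine ⟨fun n k hn hk => hτ.existsUnique_ulamDensity hn hk, fun v hv => ?_⟩
  obtain ⟨C, hC, hb⟩ := hτ.exists_bound
  have hv0 : ∀ n k, 1 ≤ n → 1 ≤ k → ∀ i, 0 ≤ v n k i := fun n k hn hk => (hv n k hn hk).1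
  have hbv : ∀ n k, 1 ≤ n → 1 ≤ k → ∀ i, v n k i ≤ C := fun n k hn hk =>
    hb n k hn hk _ (hv n k hn hk)
  have hanti : ∀ n k, 1 ≤ n → 1 ≤ k → Antitone (v n k) := fun n k hn hk =>
    hτ.ulamDensity_antitone hn hk (hv n k hn hk)
  have hsubseq : ∀ n k : ℕ → ℕ, (∀ j, 1 ≤ n j) → (∀ j, 1 ≤ k j) →
      ∃ (g : Lp ℝ 1 lebI) (φ : ℕ → ℕ), StrictMono φ ∧
        Tendsto (fun j => stepL1 (k (φ j)) (v (n (φ j)) (k (φ j)))) atTop (𝓝 g) := fun n k hn hk =>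
    exists_subseq_tendsto_stepL1 (k := k) (v := fun j => v (n j) (k j)) hk
      (fun j => hv0 _ _ (hn j) (hk j)) (fun j => hanti _ _ (hn j) (hk j)) hC
      (fun j => hbv _ _ (hn j) (hk j))
  refine ⟨⟨C, fun n k hn hk => ?_⟩, ?_, ?_, ?_⟩
  · rw [eLpNorm_exponent_top]
    refine eLpNormEssSup_le_of_ae_bound (Eventually.of_forall fun x => ?_)
    rw [Real.norm_of_nonneg (stepFn_nonneg (hv0 n k hn hk) x)]
    exact stepFn_le hC (hbv n k hn hk) x
  · have hset : {g : WeakSpace ℝ (Lp ℝ 1 lebI) | ∃ n k : ℕ, 1 ≤ n ∧ 1 ≤ k ∧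
        g = toWeakSpace ℝ (Lp ℝ 1 lebI) (stepL1 k (v n k))} = toWeakSpace ℝ (Lp ℝ 1 lebI) ''
          {g | ∃ n k : ℕ, 1 ≤ n ∧ 1 ≤ k ∧ g = stepL1 k (v n k)} := by
      ext g
      constructor
      · rintro ⟨n, k, hn, hk, rfl⟩
        exact ⟨_, ⟨n, k, hn, hk, rfl⟩, rfl⟩
      · rintro ⟨_, ⟨n, k, hn, hk, rfl⟩, rfl⟩
        exact ⟨n, k, hn, hk, rfl⟩
    rw [hset]
    refine isCompact_closure_weak (isCompact_closure_of_subseq fun u hu => ?_)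
    choose n k hn hk he using hu
    simp only [he]
    exact hsubseq n k hn hk
  · intro n k f hn hk hw
    have hsetInt := fun A => tendsto_setIntegral_of_weak hw A
    have hae := ae_tendsto_stepFn_of_tendsto_setIntegral (k := k) (v := fun j => v (n j) (k j))
      (Eventually.of_forall hk) (Eventually.of_forall fun j => hv0 _ _ (hn j) (hk j))
      (Eventually.of_forall fun j => hanti _ _ (hn j) (hk j)) (fun t => hsetInt (Iio t))
    have hL1 := tendsto_stepL1_of_ae (k := k) (v := fun j => v (n j) (k j))
      (Eventually.of_forall fun j => hv0 _ _ (hn j) (hk j)) hC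
      (Eventually.of_forall fun j => hbv _ _ (hn j) (hk j)) hae
    exact ⟨hL1, hae, fun hn' hk' => (hτ.isInvariantDensity_of_tendsto hn hk
      (fun j => hv _ _ (hn j) (hk j)) hn' hk' hL1).2.2⟩
  -- Existence: a limit point along the diagonal, shifted so that the indices start at 1.
  · obtain ⟨f, φ, hφ, hf⟩ := hsubseq (fun j => j + 1) (fun j => j + 1) (fun j => by omega)
      (fun j => by omega)
    have hφ' : Tendsto (fun j => φ j + 1) atTop atTop :=
      (tendsto_add_atTop_nat 1).comp hφ.tendsto_atTop
    have hinv : IsInvariantDensity τ f := hτ.isInvariantDensity_of_tendsto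
      (n := fun j => φ j + 1) (k := fun j => φ j + 1) (fun j => by omega) (fun j => by omega)
      (fun j => hv _ _ (by omega) (by omega)) hφ' hφ' hf
    have hpos : ∀ᶠ p : ℕ × ℕ in atTop ×ˢ atTop, 1 ≤ p.1 ∧ 1 ≤ p.2 :=
      (eventually_ge_atTop 1).prod_mk (eventually_ge_atTop 1)
    have hlim : Tendsto (fun p : ℕ × ℕ => stepL1 p.2 (v p.1 p.2)) (atTop ×ˢ atTop) (𝓝 f) := by
      -- Every sequence of index pairs tending to infinity has a subsequence whose densities
      -- converge to an invariant density, which can only be `f`. The shift by `J` discards pairs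
      -- with an index 0, where `v` is arbitrary.
      refine tendsto_of_subseq_tendsto fun ns hns => ?_
      obtain ⟨J, hJ⟩ := (hns.eventually hpos).exists_forall_of_atTop
      obtain ⟨g, ψ, hψ, hg⟩ := hsubseq (fun j => (ns (j + J)).1) (fun j => (ns (j + J)).2)
        (fun j => (hJ _ (by omega)).1) (fun j => (hJ _ (by omega)).2)
      have hshift : Tendsto (fun j => ns (ψ j + J)) atTop (atTop ×ˢ atTop) :=
        hns.comp ((tendsto_add_atTop_nat J).comp hψ.tendsto_atTop)
      have hginv : IsInvariantDensity τ g := hτ.isInvariantDensity_of_tendsto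
        (n := fun j => (ns (ψ j + J)).1) (k := fun j => (ns (ψ j + J)).2)
        (fun j => (hJ _ (by omega)).1) (fun j => (hJ _ (by omega)).2)
        (fun j => hv _ _ (hJ _ (by omega)).1 (hJ _ (by omega)).2)
        (tendsto_fst.comp hshift) (tendsto_snd.comp hshift) hg
      rw [hτ.invariantDensity_unique hginv hinv] at hg
      exact ⟨fun j => ψ j + J, hg⟩
    refine ⟨f, hinv, fun g hg => hτ.invariantDensity_unique hg hinv, hlim, ?_⟩
    exact ae_tendsto_stepFn_of_tendsto_setIntegral (k := fun p : ℕ × ℕ => p.2)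
      (v := fun p : ℕ × ℕ => v p.1 p.2) (hpos.mono fun p hp => hp.2)
      (hpos.mono fun p hp => hv0 _ _ hp.1 hp.2) (hpos.mono fun p hp => hanti _ _ hp.1 hp.2)
      (fun t => ((continuous_setIntegral (Iio t)).tendsto f).comp hlim)
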